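/- Let $k$ be a field of characteristic $0$, let $H$ be a finite-dimensional semisimple Hopf algebra over $k$, and let $B$ be a right $H$-comodule algebra with coaction $B \to B \otimes_k H$, $b \mapsto \sum b_0 \otimes b_1$. Let $A := B^{\mathrm{co}H} = \{ b \in B \mid \sum b_0 \otimes b_1 = b \otimes 1 \}$, and suppose that $A \subseteq B$ is an $H$-Galois extension, that is, the map $\beta : B \otimes_A B \to B \otimes_k H$, $b' \otimes b \mapsto \sum b' b_0 \otimes b_1$, is bijective. Let $R \subseteq A$ be a $k$-subalgebra which is central in $B$. Suppose that $A$ is a finitely generated free $R$-module, and that $B$ is a free right $A$-module of finite rank $m$. For an $R$-algebra $S$ that is free as an $R$-module with finite basis $x_1, \dots, x_n$, let $\mathrm{tr}_{S_R} : S \to R$ send $s$ to the trace of the $R$-linear map $y \mapsto sy$ on $S$ (the Hattori–Stallings trace map), and let the discriminant be $d(S,R;\mathrm{tr}_{S_R}) := \det\big([\mathrm{tr}_{S_R}(x_i x_j)]_{i,j=1}^n\big)$; it depends on the basis only up to multiplication by a unit of $R$. Then $B$ is a finitely generated free $R$-module, and $$d(B, R; \mathrm{tr}_{B_R}) = u \cdot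 d(A, R; \mathrm{tr}_{A_R})^m \quad \text{for some unit } u \in R^{\times},$$ whatever finite $R$-bases of $A$ and $B$ are used to compute the two discriminants. In particular, if every unit of $R$ is a scalar from $k$, then for all such bases the two sides agree up to a nonzero scalar $c \in k^{\times}$. -/

import Mathlib

open scoped TensorProduct

noncomputable section

namespace HopfGalois

/-- A right `H`-comodule algebra structure on the `k`-algebra `B`: a coassociative and counital
coaction `ρ : B → B ⊗ H`, `b ↦ ∑ b₀ ⊗ b₁`, which is a homomorphism of `k`-algebras. -/
structure ComoduleAlgebra (k H B : Type*) [Field k] [Ring H] [Bialgebra k H]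
    [Ring B] [Algebra k B] where
  /-- the coaction -/
  coaction : B →ₐ[k] B ⊗[k] H
  coassoc : ∀ b : B,
    TensorProduct.assoc k B H H (TensorProduct.map coaction.toLinearMap LinearMap.id (coaction b)) =
      TensorProduct.map LinearMap.id (Coalgebra.comul (R := k) (A := H)) (coaction b)
  counit : ∀ b : B,
    TensorProduct.rid k B
      (TensorProduct.map LinearMap.id (Coalgebra.counit (R := k) (A := H)) (coaction b)) = b

/-- For a subalgebra `A` of `B`, the `k`-subspace of `B ⊗ B` spanned by all
`b'a ⊗ b - b' ⊗ ab` with `a ∈ A`. -/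
def balancingRelations {k B : Type*} [Field k] [Ring B] [Algebra k B] (A : Subalgebra k B) :
    Submodule k (B ⊗[k] B) :=
  Submodule.span k
    {x | ∃ b' b : B, ∃ a ∈ A, x = (b' * a) ⊗ₜ[k] b - b' ⊗ₜ[k] (a * b)}

/-- The tensor product `B ⊗_A B` over a (not necessarily commutative) subalgebra `A` of `B`. -/
abbrev BalancedTensor {k B : Type*} [Field k] [Ring B] [Algebra k B] (A : Subalgebra k B) :
    Type _ :=
  (B ⊗[k] B) ⧸ balancingRelations A

namespace ComoduleAlgebra

variable {k H B : Type*} [Field k] [Ring H] [Bialgebra k H] [Ring B] [Algebra k B]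

/-- The coinvariants `B^{co H} = {b | ρ b = b ⊗ 1}`, a subalgebra of `B`. -/
def coinvariants (ρ : ComoduleAlgebra k H B) : Subalgebra k B :=
  AlgHom.equalizer ρ.coaction
    (Algebra.TensorProduct.includeLeft : B →ₐ[k] B ⊗[k] H)

theorem mem_coinvariants (ρ : ComoduleAlgebra k H B) (b : B) :
    b ∈ ρ.coinvariants ↔ ρ.coaction b = b ⊗ₜ[k] (1 : H) :=
  Iff.rfl

/-- The map `B ⊗ B → B ⊗ H`, `b' ⊗ b ↦ ∑ b' b₀ ⊗ b₁ = (b' ⊗ 1) ρ(b)`. -/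
def preCanonicalMap (ρ : ComoduleAlgebra k H B) : B ⊗[k] B →ₗ[k] B ⊗[k] H :=
  LinearMap.mul' k (B ⊗[k] H) ∘ₗ
    TensorProduct.map
      (Algebra.TensorProduct.includeLeft : B →ₐ[k] B ⊗[k] H).toLinearMap
      ρ.coaction.toLinearMap

@[simp]
theorem preCanonicalMap_tmul (ρ : ComoduleAlgebra k H B) (b' b : B) :
    ρ.preCanonicalMap (b' ⊗ₜ[k] b) = (b' ⊗ₜ[k] (1 : H)) * ρ.coaction b := by
  simp [preCanonicalMap]

theorem balancingRelations_le_ker (ρ : ComoduleAlgebra k H B) :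
    balancingRelations ρ.coinvariants ≤ LinearMap.ker ρ.preCanonicalMap := by
  refine Submodule.span_le.2 ?_
  rintro _ ⟨b', b, a, ha, rfl⟩
  rw [mem_coinvariants] at ha
  simp [ha, ← mul_assoc]

/-- The canonical map `β : B ⊗_{B^{co H}} B → B ⊗ H`, `b' ⊗ b ↦ ∑ b' b₀ ⊗ b₁`. -/
def canonicalMap (ρ : ComoduleAlgebra k H B) :
    BalancedTensor ρ.coinvariants →ₗ[k] B ⊗[k] H :=
  (balancingRelations ρ.coinvariants).liftQ ρ.preCanonicalMap ρ.balancingRelations_le_ker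

/-- The extension `B^{co H} ⊆ B` is `H`-Galois. -/
def IsGalois (ρ : ComoduleAlgebra k H B) : Prop :=
  Function.Bijective ρ.canonicalMap

/-- If the image of the `R`-algebra structure map of `B` lies in `B^{co H}`, then `B^{co H}` is an
`R`-subalgebra of `B`; the underlying set is that of `ρ.coinvariants`. -/
def coinvariantsOver (ρ : ComoduleAlgebra k H B) (R : Type*) [CommRing R] [Algebra R B]
    (hR : ∀ r : R, algebraMap R B r ∈ ρ.coinvariants) : Subalgebra R B :=
  { ρ.coinvariants.toSubsemiring with algebraMap_mem' := hR }

end ComoduleAlgebra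

/-- `B` is a free right module of rank `m` over its subalgebra `A`: there are `x₁, …, x_m` in `B`
such that every element of `B` is uniquely of the form `∑ x_i a_i` with `a_i ∈ A`. -/
def IsFreeRight {k B : Type*} [Field k] [Ring B] [Algebra k B] (A : Subalgebra k B) (m : ℕ) :
    Prop :=
  ∃ x : Fin m → B, ∀ b : B, ∃! a : Fin m → A, b = ∑ i, x i * (a i : B)

/-- The Hattori-Stallings trace map `S → R` of an algebra `S` that is a finitely generated free
module over the commutative ring `R`: the trace `∑ x_i^*(s x_i)` of the left multiplication by
`s` on the `R`-module `S`. -/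
def trace (R S : Type*) [CommRing R] [Ring S] [Algebra R S] : S →ₗ[R] R :=
  LinearMap.trace R S ∘ₗ LinearMap.mul R S

/-- The determinant of `[tr(x_i x_j)]` for an `R`-basis `x` of `S`: the discriminant
`d(S, R; tr)`, computed in the basis `x`. -/
def discriminant {R S : Type*} [CommRing R] [Ring S] [Algebra R S] (tr : S →ₗ[R] R)
    {n : ℕ} (x : Module.Basis (Fin n) R S) : R :=
  Matrix.det (Matrix.of fun i j => tr (x i * x j))

end HopfGalois

end

namespace HopfGalois

open Coalgebra HopfAlgebra

/-! Let `λ` be `twistedTrace`, `x ↦ Tr(y ↦ x S²(y))`. It is an integral in `H*`, so `E(b) = ∑ λ(b₁)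
b₀` (`expectation`) is an `A`-bimodule map `B → A`. Let `t` be the two-sided integral of `H` with
`ε(t) = 1`. The Galois property yields `∑ r ⊗ l` with image `1 ⊗ t` under the canonical map, and
then `∑ r E(l b) = b = ∑ E(b r) l` (`exists_casimir`). So `E` is a Frobenius system: a right
`A`-basis `x` of `B` has a left `A`-basis `y` with `E(y_i x_j) = δ_ij` (`exists_dualBasis`).

If `z` is an `R`-basis of `A`, the matrix of `tr_A(E(z_p y_i x_j z_q))` is block diagonal with `m`
copies of the discriminant matrix of `A`. Passing to one common basis of `B` costs a unit
(`exists_det_dualBasis`). Finally `tr_B = (m / dim H) tr_A ∘ E` (`trace_eq_smul_expectation`),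
because `tr_B(a) = m tr_A(a)` on `A` and `tr_B(E(b)) = dim H · tr_B(b)`. In characteristic zero the
constant is invertible.

The last trace identity rests on `S² = 1`, the Larson-Radford theorem (`antipode_antipode`), proved
after passing to an algebraic closure. `S⁴` is inner via a group-like element of finite order, so
`S²` is an automorphism of finite order. Its trace is `1` plus a sum of terms `|tr A|²`, hence
nonzero; this makes the group-like element trivial and `S⁴ = 1`. An integrality argument with the
regular character then forces `Tr S² = ± dim H`, so `S² = ± 1`, and `S²(1) = 1` fixes the sign.

Most trace identities over coactions come from one cyclicity lemma, `trace_sw_sw`. -/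

/-- Unbundled linearity, in a form that `fun_prop` can discharge. -/
@[fun_prop]
structure IsLin (k : Type*) {M N : Type*} [CommSemiring k] [AddCommMonoid M] [AddCommMonoid N]
    [Module k M] [Module k N] (f : M → N) : Prop where
  map_add : ∀ x y, f (x + y) = f x + f y
  map_smul : ∀ (c : k) x, f (c • x) = c • f x

namespace IsLin

variable {k : Type*} [CommSemiring k] {M N P : Type*} [AddCommMonoid M] [AddCommMonoid N]
  [AddCommMonoid P] [Module k M] [Module k N] [Module k P]

/-- The linear map with underlying function `f`. -/
@[simps] def mk' {f : M → N} (hf : IsLin k f) : M →ₗ[k] N where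
  toFun := f
  map_add' := hf.map_add
  map_smul' := hf.map_smul

theorem map_sum {f : M → N} (hf : IsLin k f) {ι : Type*} (s : Finset ι) (g : ι → M) :
    f (∑ i ∈ s, g i) = ∑ i ∈ s, f (g i) :=
  _root_.map_sum hf.mk' g s

@[fun_prop]
theorem id' : IsLin k (fun x : M => x) := ⟨fun _ _ => rfl, fun _ _ => rfl⟩

@[fun_prop]
theorem comp {f : N → P} {g : M → N} (hf : IsLin k f) (hg : IsLin k g) :
    IsLin k (fun x => f (g x)) :=
  ⟨fun x y => by rw [hg.map_add, hf.map_add], fun c x => by rw [hg.map_smul, hf.map_smul]⟩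

@[fun_prop]
theorem linearMap (f : M →ₗ[k] N) : IsLin k (fun x => f x) := ⟨f.map_add, f.map_smul⟩

@[fun_prop]
theorem linearEquiv (f : M ≃ₗ[k] N) : IsLin k (fun x => f x) := ⟨f.map_add, f.map_smul⟩

@[fun_prop]
theorem linearMap_apply {f : M → N →ₗ[k] P} (hf : IsLin k f) (n : N) :
    IsLin k (fun x => f x n) :=
  ⟨fun x y => by rw [hf.map_add]; rfl, fun c x => by rw [hf.map_smul]; rfl⟩

@[fun_prop]
theorem sum {ι : Type*} (s : Finset ι) {f : ι → M → N} (hf : ∀ i, IsLin k (f i)) :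
    IsLin k (fun x => ∑ i ∈ s, f i x) :=
  ⟨fun x y => by simp [(hf _).map_add, Finset.sum_add_distrib],
    fun c x => by simp [(hf _).map_smul, Finset.smul_sum]⟩

@[fun_prop]
theorem smul_left {f : M → k} (hf : IsLin k f) (n : N) : IsLin k (fun x => f x • n) :=
  ⟨fun x y => by rw [hf.map_add, add_smul], fun c x => by rw [hf.map_smul, smul_assoc]⟩

@[fun_prop]
theorem smul_right {f : M → N} (hf : IsLin k f) (c : k) : IsLin k (fun x => c • f x) :=
  ⟨fun x y => by rw [hf.map_add, smul_add], fun d x => by rw [hf.map_smul, smul_comm]⟩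

@[fun_prop]
theorem tmul_left {f : M → N} (hf : IsLin k f) (n : P) : IsLin k (fun x => f x ⊗ₜ[k] n) :=
  ⟨fun x y => by rw [hf.map_add, TensorProduct.add_tmul],
    fun c x => by rw [hf.map_smul, TensorProduct.smul_tmul']⟩

@[fun_prop]
theorem tmul_right {f : M → N} (hf : IsLin k f) (n : P) : IsLin k (fun x => n ⊗ₜ[k] f x) :=
  ⟨fun x y => by rw [hf.map_add, TensorProduct.tmul_add],
    fun c x => by rw [hf.map_smul, TensorProduct.tmul_smul]⟩

variable {A : Type*} [Semiring A] [Algebra k A]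

@[fun_prop]
theorem mul_left {f : M → A} (hf : IsLin k f) (a : A) : IsLin k (fun x => f x * a) :=
  ⟨fun x y => by rw [hf.map_add, add_mul], fun c x => by rw [hf.map_smul, smul_mul_assoc]⟩

@[fun_prop]
theorem mul_right {f : M → A} (hf : IsLin k f) (a : A) : IsLin k (fun x => a * f x) :=
  ⟨fun x y => by rw [hf.map_add, mul_add], fun c x => by rw [hf.map_smul, mul_smul_comm]⟩

end IsLin

/-! ### Sweedler sums. -/

section tsum

variable {k : Type*} [CommSemiring k] {M N P Q : Type*} [AddCommMonoid M] [AddCommMonoid N]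
  [AddCommMonoid P] [AddCommMonoid Q] [Module k M] [Module k N] [Module k P] [Module k Q]

/-- `sw t F = ∑ F t₀ t₁` for `t = ∑ t₀ ⊗ t₁`, where `F` is meant to be bilinear. -/
noncomputable def sw (t : M ⊗[k] N) (F : M → N → P) : P :=
  -- One representation of `t` is fixed once and for all. Interchanging sums and pulling out linear
  -- maps therefore needs no bilinearity of `F`; only changing the representation does.
  ∑ i ∈ (TensorProduct.exists_finset t).choose, F i.1 i.2

omit [Module k P] in
theorem sw_congr {t : M ⊗[k] N} {F G : M → N → P} (h : ∀ m n, F m n = G m n) : sw t F = sw t G :=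
  congrArg (sw t) (funext₂ h)

/-- Unbundled bilinearity. -/
def IsBilin (k : Type*) {M N P : Type*} [CommSemiring k] [AddCommMonoid M] [AddCommMonoid N]
    [AddCommMonoid P] [Module k M] [Module k N] [Module k P] (F : M → N → P) : Prop :=
  (∀ n, IsLin k (fun m => F m n)) ∧ ∀ m, IsLin k (F m)

/-- The linear map on the tensor product given by a bilinear function. -/
noncomputable def IsBilin.lift {F : M → N → P} (hF : IsBilin k F) : M ⊗[k] N →ₗ[k] P :=
  TensorProduct.lift (LinearMap.mk₂ k F (fun a b n => (hF.1 n).map_add a b)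
    (fun c a n => (hF.1 n).map_smul c a) (fun m => (hF.2 m).map_add)
    (fun c m => (hF.2 m).map_smul c))

@[simp]
theorem IsBilin.lift_tmul {F : M → N → P} (hF : IsBilin k F) (m : M) (n : N) :
    hF.lift (m ⊗ₜ n) = F m n := by
  simp [IsBilin.lift]

theorem sw_eq_lift (t : M ⊗[k] N) {F : M → N → P} (hF : IsBilin k F) : sw t F = hF.lift t := by
  conv_rhs => rw [(TensorProduct.exists_finset t).choose_spec]
  simp [sw]

theorem sw_tmul (m : M) (n : N) {F : M → N → P} (hF : IsBilin k F) :
    sw (m ⊗ₜ[k] n) F = F m n := by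
  rw [sw_eq_lift _ hF, hF.lift_tmul]

@[fun_prop]
theorem IsLin.sw_left {t : Q → M ⊗[k] N} (ht : IsLin k t) {F : M → N → P}
    (hF₁ : ∀ n, IsLin k (fun m => F m n)) (hF₂ : ∀ m, IsLin k (F m)) :
    IsLin k (fun q => sw (t q) F) := by
  have hF : IsBilin k F := ⟨hF₁, hF₂⟩
  simp only [sw_eq_lift _ hF]
  fun_prop

@[fun_prop]
theorem IsLin.sw_right (t : M ⊗[k] N) {F : Q → M → N → P} (hF : ∀ m n, IsLin k (fun q => F q m n)) :
    IsLin k (fun q => sw t (F q)) := by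
  unfold sw
  fun_prop

theorem map_sw (t : M ⊗[k] N) (F : M → N → P) {f : P → Q} (hf : IsLin k f) :
    f (sw t F) = sw t (fun m n => f (F m n)) := by
  unfold sw
  rw [hf.map_sum]

omit [Module k P] in
theorem sw_finsetSum {ι : Type*} (s : Finset ι) (t : M ⊗[k] N) (F : ι → M → N → P) :
    sw t (fun m n => ∑ i ∈ s, F i m n) = ∑ i ∈ s, sw t (F i) := by
  unfold sw
  rw [Finset.sum_comm]

theorem sw_smul (c : k) (t : M ⊗[k] N) (F : M → N → P) :
    sw t (fun m n => c • F m n) = c • sw t F := by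
  unfold sw
  rw [Finset.smul_sum]

theorem sw_tmul_self (t : M ⊗[k] N) : sw t (fun m n => m ⊗ₜ[k] n) = t := by
  conv_rhs => rw [(TensorProduct.exists_finset t).choose_spec]
  simp [sw]

omit [Module k P] in
theorem sw_comm {M' N' : Type*} [AddCommMonoid M'] [AddCommMonoid N'] [Module k M'] [Module k N']
    (t : M ⊗[k] N) (u : M' ⊗[k] N') (F : M → N → M' → N' → P) :
    sw t (fun m n => sw u (fun m' n' => F m n m' n')) =
      sw u (fun m' n' => sw t (fun m n => F m n m' n')) := by
  unfold sw
  rw [Finset.sum_comm]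

end tsum

/-! ### Coalgebra axioms in Sweedler form. -/

section Coalgebra

variable {k H M : Type*} [CommSemiring k] [AddCommMonoid H] [Module k H] [Coalgebra k H]
  [AddCommMonoid M] [Module k M]

local notation "Δ" => Coalgebra.comul (R := k)

theorem sw_assoc {X Y Z : Type*} [AddCommMonoid X] [Module k X] [AddCommMonoid Y] [Module k Y]
    [AddCommMonoid Z] [Module k Z] (t : X ⊗[k] Y) (z : Z) {F : X → Y → Z → M}
    (h₁ : ∀ b c, IsLin k (fun a => F a b c)) (h₂ : ∀ a c, IsLin k (fun b => F a b c))
    (h₃ : ∀ a b, IsLin k (fun c => F a b c)) :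
    sw (TensorProduct.assoc k X Y Z (t ⊗ₜ z)) (fun a q => sw q (F a)) =
      sw t (fun a b => F a b z) := by
  have hq : ∀ a, IsBilin k (F a) := fun a => ⟨fun c => h₂ a c, fun b => h₃ a b⟩
  have hG : IsBilin k (fun a (q : Y ⊗[k] Z) => sw q (F a)) :=
    ⟨fun _ => by fun_prop, fun a => by fun_prop⟩
  have l : IsLin k
      (fun t => sw (TensorProduct.assoc k X Y Z (t ⊗ₜ z)) (fun a q => sw q (F a))) := by
    simp only [sw_eq_lift _ hG]
    exact (IsLin.linearMap hG.lift).comp ((IsLin.linearMap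
      (TensorProduct.assoc k X Y Z).toLinearMap).comp (by fun_prop))
  conv_lhs => rw [← sw_tmul_self t]
  rw [map_sw _ _ l]
  congr! 3 with a b
  rw [TensorProduct.assoc_tmul, sw_tmul _ _ hG, sw_tmul _ _ (hq a)]

theorem sw_comul_assoc (x : H) {F : H → H → H → M} (h₁ : ∀ b c, IsLin k (fun a => F a b c))
    (h₂ : ∀ a c, IsLin k (fun b => F a b c)) (h₃ : ∀ a b, IsLin k (fun c => F a b c)) :
    sw (Δ x) (fun p c => sw (Δ p) (fun a b => F a b c)) =
      sw (Δ x) (fun a q => sw (Δ q) (F a)) := by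
  have hq : ∀ a, IsBilin k (F a) := fun a => ⟨fun c => h₂ a c, fun b => h₃ a b⟩
  have hG : IsBilin k (fun a (q : H ⊗[k] H) => sw q (F a)) :=
    ⟨fun _ => by fun_prop, fun a => by fun_prop⟩
  have e := congrArg (fun t => sw t (fun a (q : H ⊗[k] H) => sw q (F a)))
    (coassoc_apply (R := k) x)
  simp only [sw_eq_lift _ hG] at e
  rw [← sw_tmul_self (Δ x)] at e
  have l₁ : IsLin k (fun t => hG.lift (TensorProduct.assoc k H H H (comul.rTensor H t))) :=
    IsLin.linearMap (hG.lift ∘ₗ (TensorProduct.assoc k H H H).toLinearMap ∘ₗ comul.rTensor H)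
  have l₂ : IsLin k (fun t => hG.lift (comul.lTensor H t)) :=
    IsLin.linearMap (hG.lift ∘ₗ comul.lTensor H)
  rw [map_sw _ _ l₁, map_sw _ _ l₂] at e
  simp only [LinearMap.rTensor_tmul, LinearMap.lTensor_tmul, IsBilin.lift_tmul] at e
  simp only [← sw_eq_lift _ hG, sw_assoc _ _ h₁ h₂ h₃] at e
  exact e

theorem sw_comul_counit_left (x : H) {f : H → M} (hf : IsLin k f) :
    sw (Δ x) (fun a b => counit (R := k) a • f b) = f x := by
  have hG : IsBilin k (fun (c : k) b => c • f b) := ⟨fun _ => by fun_prop, fun a => by fun_prop⟩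
  have e := congrArg hG.lift (rTensor_counit_comul (R := k) x)
  rw [← sw_tmul_self (Δ x)] at e
  have l : IsLin k (fun t : H ⊗[k] H => hG.lift (counit.rTensor H t)) :=
    IsLin.linearMap (hG.lift ∘ₗ counit.rTensor H)
  rw [map_sw _ _ l] at e
  simpa using e

theorem sw_comul_counit_right (x : H) {f : H → M} (hf : IsLin k f) :
    sw (Δ x) (fun a b => counit (R := k) b • f a) = f x := by
  have hG : IsBilin k (fun a (c : k) => c • f a) := ⟨fun _ => by fun_prop, fun a => by fun_prop⟩
  have e := congrArg hG.lift (lTensor_counit_comul (R := k) x)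
  rw [← sw_tmul_self (Δ x)] at e
  have l : IsLin k (fun t : H ⊗[k] H => hG.lift (counit.lTensor H t)) :=
    IsLin.linearMap (hG.lift ∘ₗ counit.lTensor H)
  rw [map_sw _ _ l] at e
  simpa using e

end Coalgebra

/-! ### Antipode identities. -/

section Hopf

variable {k H M : Type*} [CommSemiring k] [Semiring H] [HopfAlgebra k H]
  [AddCommMonoid M] [Module k M]

local notation "Δ" => Coalgebra.comul (R := k)
local notation "S" => HopfAlgebra.antipode k
local notation "ε" => Coalgebra.counit (R := k)

theorem sw_one {A B : Type*} [Semiring A] [Algebra k A] [Semiring B] [Algebra k B]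
    {F : A → B → M} (hF : IsBilin k F) : sw (1 : A ⊗[k] B) F = F 1 1 :=
  sw_tmul 1 1 hF

theorem sw_mul {A B : Type*} [Semiring A] [Algebra k A] [Semiring B] [Algebra k B]
    (t u : A ⊗[k] B) {F : A → B → M} (hF : IsBilin k F) :
    sw (t * u) F = sw t (fun a b => sw u (fun c d => F (a * c) (b * d))) := by
  obtain ⟨h₁, h₂⟩ := id hF
  rw [sw_eq_lift _ hF]
  conv_lhs => rw [← sw_tmul_self t, ← sw_tmul_self u]
  have l₁ (u : A ⊗[k] B) : IsLin k (fun t : A ⊗[k] B => hF.lift (t * u)) := by fun_prop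
  have l₂ (t : A ⊗[k] B) : IsLin k (fun u : A ⊗[k] B => hF.lift (t * u)) := by fun_prop
  rw [map_sw _ _ (l₁ _)]
  congr! 3 with a b
  rw [map_sw _ _ (l₂ _)]
  congr! 3 with c d
  simp

theorem sw_comul_mul (x y : H) {F : H → H → M} (h₁ : ∀ b, IsLin k (fun a => F a b))
    (h₂ : ∀ a, IsLin k (F a)) :
    sw (Δ (x * y)) F = sw (Δ x) (fun a b => sw (Δ y) (fun c d => F (a * c) (b * d))) := by
  rw [Bialgebra.comul_mul, sw_mul _ _ ⟨h₁, h₂⟩]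

theorem sw_antipode_mul (x : H) : sw (Δ x) (fun a b => S a * b) = ε x • (1 : H) := by
  have e := mul_antipode_rTensor_comul_apply (R := k) x
  rw [← sw_tmul_self (Δ x)] at e
  have l : IsLin k (fun t : H ⊗[k] H => LinearMap.mul' k H ((S).rTensor H t)) :=
    IsLin.linearMap (LinearMap.mul' k H ∘ₗ (S).rTensor H)
  rw [map_sw _ _ l] at e
  simpa [Algebra.algebraMap_eq_smul_one] using e

theorem sw_mul_antipode (x : H) : sw (Δ x) (fun a b => a * S b) = ε x • (1 : H) := by
  have e := mul_antipode_lTensor_comul_apply (R := k) x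
  rw [← sw_tmul_self (Δ x)] at e
  have l : IsLin k (fun t : H ⊗[k] H => LinearMap.mul' k H ((S).lTensor H t)) :=
    IsLin.linearMap (LinearMap.mul' k H ∘ₗ (S).lTensor H)
  rw [map_sw _ _ l] at e
  simpa [Algebra.algebraMap_eq_smul_one] using e

theorem sw_antipode_mul' (x : H) {f : H → M} (hf : IsLin k f) :
    sw (Δ x) (fun a b => f (S a * b)) = ε x • f 1 := by
  rw [← map_sw _ _ hf, sw_antipode_mul, hf.map_smul]

theorem sw_mul_antipode' (x : H) {f : H → M} (hf : IsLin k f) :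
    sw (Δ x) (fun a b => f (a * S b)) = ε x • f 1 := by
  rw [← map_sw _ _ hf, sw_mul_antipode, hf.map_smul]

/-- In the convolution algebra `Hom(H, H ⊗ H)`, `Δ ∘ S` is a left inverse of `Δ`, and the flipped `S
⊗ S` is a right inverse (`key`); hence they agree. -/
theorem comul_antipode (x : H) : Δ (S x) = sw (Δ x) (fun a b => S b ⊗ₜ[k] S a) := by
  have key (x : H) : sw (Δ x) (fun a b => Δ a * sw (Δ b) (fun c d => S d ⊗ₜ[k] S c)) =
      ε x • (1 : H ⊗[k] H) := by
    calc _ = sw (Δ x) (fun p b => sw (Δ p) (fun a a' =>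
          sw (Δ b) (fun c d => (a * S d) ⊗ₜ[k] (a' * S c)))) := by
          congr! 3 with p b
          conv_lhs => rw [← sw_tmul_self (Δ p)]
          rw [map_sw _ _ (f := fun t => t * sw (Δ b) (fun c d => S d ⊗ₜ[k] S c)) (by fun_prop)]
          congr! 3 with a a'
          rw [map_sw _ _ (f := fun t => (a ⊗ₜ[k] a') * t) (by fun_prop)]
          simp
      _ = sw (Δ x) (fun a q => sw (Δ q) (fun a' b =>
          sw (Δ b) (fun c d => (a * S d) ⊗ₜ[k] (a' * S c)))) := by
          rw [sw_comul_assoc] <;> intros <;> fun_prop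
      _ = sw (Δ x) (fun a q => sw (Δ q) (fun b d => sw (Δ b) (fun a' c =>
            (a * S d) ⊗ₜ[k] (a' * S c)))) := by
          congr! 3 with a q
          rw [← sw_comul_assoc] <;> intros <;> fun_prop
      _ = sw (Δ x) (fun a q => sw (Δ q) (fun b d => ε b • ((a * S d) ⊗ₜ[k] (1 : H)))) := by
          refine sw_congr fun a q => sw_congr fun b d => ?_
          exact sw_mul_antipode' b (f := fun t => (a * S d) ⊗ₜ[k] t) (by fun_prop)
      _ = sw (Δ x) (fun a q => (a * S q) ⊗ₜ[k] (1 : H)) := by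
          congr! 3 with a q
          rw [sw_comul_counit_left (f := fun d => (a * S d) ⊗ₜ[k] (1 : H))]
          fun_prop
      _ = _ := sw_mul_antipode' x (f := fun t => t ⊗ₜ[k] (1 : H)) (by fun_prop)
  calc Δ (S x) = sw (Δ x) (fun a b => ε b • Δ (S a)) :=
        (sw_comul_counit_right x (f := fun a => Δ (S a)) (by fun_prop)).symm
    _ = sw (Δ x) (fun a q => Δ (S a) * sw (Δ q) (fun b c =>
          Δ b * sw (Δ c) (fun c d => S d ⊗ₜ[k] S c))) := by
        congr! 3 with a q
        rw [key, mul_smul_comm, mul_one]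
    _ = sw (Δ x) (fun a q => sw (Δ q) (fun b c => Δ (S a) *
          (Δ b * sw (Δ c) (fun c d => S d ⊗ₜ[k] S c)))) := by
        congr! 3 with a q
        exact map_sw _ _ (f := fun t => Δ (S a) * t) (by fun_prop)
    _ = sw (Δ x) (fun q c => sw (Δ q) (fun a b => Δ (S a) *
          (Δ b * sw (Δ c) (fun c d => S d ⊗ₜ[k] S c)))) := by
        rw [sw_comul_assoc] <;> intros <;> fun_prop
    _ = sw (Δ x) (fun q c => ε q • sw (Δ c) (fun c d => S d ⊗ₜ[k] S c)) := by
        congr! 3 with q c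
        simp_rw [← mul_assoc, ← Bialgebra.comul_mul]
        rw [sw_antipode_mul' q (f := fun t => Δ t * sw (Δ c) (fun c d => S d ⊗ₜ[k] S c))
          (by fun_prop), Bialgebra.comul_one, one_mul]
    _ = _ := sw_comul_counit_left x (f := fun c => sw (Δ c) (fun c d => S d ⊗ₜ[k] S c))
        (by fun_prop)

theorem sw_comul_antipode (x : H) {F : H → H → M} (h₁ : ∀ b, IsLin k (fun a => F a b))
    (h₂ : ∀ a, IsLin k (F a)) :
    sw (Δ (S x)) F = sw (Δ x) (fun a b => F (S b) (S a)) := by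
  have hF : IsBilin k F := ⟨h₁, h₂⟩
  rw [comul_antipode, sw_eq_lift _ hF, map_sw _ _ (IsLin.linearMap hF.lift)]
  simp

end Hopf

/-! ### Cyclicity of the trace along a coaction. -/

section Trace

variable {k R V C : Type*} [Field k] [CommRing R] [Algebra k R] [AddCommGroup V] [Module k V]
  [Module R V] [IsScalarTower k R V] [AddCommGroup C] [Module k C]

/-- `v ↦ ∑ φ(v₁) v₀` for a linear map `ρ : V → V ⊗ C`, `v ↦ ∑ v₀ ⊗ v₁`. -/
noncomputable def contract (ρ : V →ₗ[R] V ⊗[k] C) (φ : C →ₗ[k] k) : V →ₗ[R] V :=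
  (TensorProduct.AlgebraTensorModule.rid k R V).toLinearMap ∘ₗ
    TensorProduct.AlgebraTensorModule.lTensor R V φ ∘ₗ ρ

theorem contract_apply (ρ : V →ₗ[R] V ⊗[k] C) (φ : C →ₗ[k] k) (v : V) :
    contract ρ φ v = sw (ρ v) (fun w c => φ c • w) := by
  have l : IsLin k (fun t : V ⊗[k] C => TensorProduct.AlgebraTensorModule.rid k R V
      (TensorProduct.AlgebraTensorModule.lTensor R V φ t)) :=
    IsLin.linearMap (((TensorProduct.AlgebraTensorModule.rid k R V).toLinearMap ∘ₗ
      TensorProduct.AlgebraTensorModule.lTensor R V φ).restrictScalars k)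
  rw [contract, LinearMap.comp_apply, LinearMap.comp_apply]
  conv_lhs => rw [← sw_tmul_self (ρ v)]
  exact (map_sw _ _ l).trans (by simp)

/-- With `C_i` the contraction of `ρ` by the `i`-th coordinate form and `a_ij = F(e_i, e_j)`, one
has `P = ∑ a_ij C_i T C_j` and `Q = ∑ a_ij T C_j C_i`, so the traces agree by cyclicity. -/
theorem trace_sw_sw [Module.Finite k C] (ρ : V →ₗ[R] V ⊗[k] C) (T P Q : V →ₗ[R] V)
    {F : C → C → k} (hF₁ : ∀ d, IsLin k (fun c => F c d)) (hF₂ : ∀ c, IsLin k (F c))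
    (hP : ∀ y, P y = sw (ρ y) (fun v c => sw (ρ (T v)) (fun w d => F d c • w)))
    (hQ : ∀ y, Q y = T (sw (ρ y) (fun v c => sw (ρ v) (fun w d => F c d • w)))) :
    LinearMap.trace R V P = LinearMap.trace R V Q := by
  let e := Module.finBasis k C
  have hF (c d : C) : F c d = ∑ i, ∑ j, F (e i) (e j) * (e.coord i c * e.coord j d) := by
    conv_lhs => rw [← e.sum_repr c, ← e.sum_repr d]
    rw [(hF₁ _).map_sum]
    refine Finset.sum_congr rfl fun i _ => ?_
    rw [(hF₂ _).map_sum]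
    refine Finset.sum_congr rfl fun j _ => ?_
    rw [(hF₁ _).map_smul, (hF₂ _).map_smul]
    simp only [smul_eq_mul, Module.Basis.coord_apply]
    ring
  obtain ⟨a, hF'⟩ : ∃ a : Fin (Module.finrank k C) → Fin (Module.finrank k C) → k,
      ∀ (c d : C) (w : V), F c d • w =
        ∑ i, ∑ j, a i j • (e.coord j d • (e.coord i c • w)) := by
    refine ⟨fun i j => F (e i) (e j), fun c d w => ?_⟩
    rw [hF, Finset.sum_smul]
    refine Finset.sum_congr rfl fun i _ => ?_
    rw [Finset.sum_smul]
    refine Finset.sum_congr rfl fun j _ => ?_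
    simp only [smul_smul]
    ring_nf
  have smul_comp (c : k) (A : V →ₗ[R] V) (v : V) : A (c • v) = c • A v :=
    (A.restrictScalars k).map_smul c v
  have eP : P = ∑ i, ∑ j, a i j •
      (contract ρ (e.coord i) * (T * contract ρ (e.coord j))) := by
    ext y
    have l (i) : IsLin k (fun v => contract ρ (e.coord i) (T v)) :=
      IsLin.linearMap ((contract ρ (e.coord i) ∘ₗ T).restrictScalars k)
    have term (i j) : contract ρ (e.coord i) (T (contract ρ (e.coord j) y)) =
        sw (ρ y) (fun v c => e.coord j c • sw (ρ (T v)) (fun w d => e.coord i d • w)) := by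
      rw [contract_apply ρ (e.coord j) y, map_sw _ _ (l i)]
      refine sw_congr fun v c => ?_
      rw [(l i).map_smul, contract_apply]
    simp only [LinearMap.sum_apply, LinearMap.smul_apply, Module.End.mul_apply, term, hP, hF',
      sw_finsetSum, sw_smul]
  have eQ : Q = ∑ i, ∑ j, a i j •
      ((T * contract ρ (e.coord j)) * contract ρ (e.coord i)) := by
    ext y
    have term (i j) : T (contract ρ (e.coord j) (contract ρ (e.coord i) y)) =
        T (sw (ρ y) (fun v c => sw (ρ v) (fun w d => e.coord j d • (e.coord i c • w)))) := by
      rw [contract_apply ρ (e.coord i) y,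
        map_sw (f := contract ρ (e.coord j)) _ _
          (IsLin.linearMap ((contract ρ (e.coord j)).restrictScalars k))]
      congr 1
      refine sw_congr fun v c => ?_
      rw [smul_comp, contract_apply, ← sw_smul]
      exact sw_congr fun w d => smul_comm _ _ _
    have lT : IsLin k T := IsLin.linearMap (T.restrictScalars k)
    simp only [LinearMap.sum_apply, LinearMap.smul_apply, Module.End.mul_apply, term, hQ, hF',
      sw_finsetSum, sw_smul, lT.map_sum, smul_comp]
  have tr (c : k) (A : V →ₗ[R] V) :
      LinearMap.trace R V (c • A) = c • LinearMap.trace R V A :=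
    ((LinearMap.trace R V).restrictScalars k).map_smul c A
  rw [eP, eQ]
  simp only [_root_.map_sum, tr, LinearMap.trace_mul_comm R (contract ρ (e.coord _))]

end Trace

theorem sw_swap {k M N P : Type*} [CommSemiring k] [AddCommMonoid M] [AddCommMonoid N]
    [AddCommMonoid P] [Module k M] [Module k N] [Module k P] (t : M ⊗[k] N) {F : N → M → P}
    (h₁ : ∀ m, IsLin k (fun n => F n m)) (h₂ : ∀ n, IsLin k (F n)) :
    sw (TensorProduct.comm k M N t) F = sw t (fun m n => F n m) := by
  have hF : IsBilin k F := ⟨h₁, h₂⟩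
  conv_lhs => rw [← sw_tmul_self t]
  rw [sw_eq_lift _ hF, map_sw (f := fun t => hF.lift (TensorProduct.comm k M N t)) _ _
    (IsLin.linearMap (hF.lift ∘ₗ (TensorProduct.comm k M N).toLinearMap))]
  simp

/-! ### Integrals, and the twisted trace as an integral in the dual. -/

section Hopf

variable {k H : Type*} [Field k] [Ring H] [HopfAlgebra k H]

local notation "Δ" => Coalgebra.comul (R := k)
local notation "S" => HopfAlgebra.antipode k
local notation "ε" => Coalgebra.counit (R := k)

variable (k) in
/-- A two-sided integral of a Hopf algebra. -/
structure IsIntegral (t : H) : Prop where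
  mul_left : ∀ x, x * t = ε x • t
  mul_right : ∀ x, t * x = ε x • t

theorem IsIntegral.eq_smul {t u : H} (ht : IsIntegral k t) (h1 : ε t = 1)
    (hu : ∀ x, x * u = ε x • u) : u = ε u • t := by
  rw [← ht.mul_right, hu, h1, one_smul]

variable (k H) in
/-- A semisimple Hopf algebra has a two-sided integral of counit `1`. -/
theorem exists_isIntegral [IsSemisimpleRing H] : ∃ t : H, IsIntegral k t ∧ ε t = 1 := by
  have left : ∃ t : H, (∀ x, x * t = ε x • t) ∧ ε t = 1 := by
    -- By semisimplicity the augmentation ideal has a complement, and the component of `1` in it is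
    -- a left integral of counit `1`. The right-handed version is the same over `Hᵐᵒᵖ`.
    let I : Submodule H H := RingHom.ker (Bialgebra.counitAlgHom k H)
    have hI (x : H) : x ∈ I ↔ ε x = 0 := by simp [I, RingHom.mem_ker]
    obtain ⟨J, hJ⟩ := exists_isCompl I
    obtain ⟨i, hi, j, hj, hij⟩ := Submodule.mem_sup.1
      (show (1 : H) ∈ I ⊔ J from hJ.sup_eq_top ▸ Submodule.mem_top)
    refine ⟨j, fun x => ?_, ?_⟩
    · have h : (x - algebraMap k H (ε x)) * j ∈ I ⊓ J :=
        ⟨(hI _).2 (by simp), J.smul_mem _ hj⟩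
      rw [hJ.inf_eq_bot, Submodule.mem_bot, sub_mul, sub_eq_zero] at h
      rw [h, Algebra.smul_def]
    · have := congrArg (fun y => ε y) hij
      simpa [(hI i).1 hi] using this
  have right : ∃ t : H, (∀ x, t * x = ε x • t) ∧ ε t = 1 := by
    let I : Submodule Hᵐᵒᵖ H :=
      { carrier := {x | ε x = 0}
        add_mem' := fun {a b} ha hb => by simp_all
        zero_mem' := by simp
        smul_mem' := fun c x hx => by simp_all }
    have hI (x : H) : x ∈ I ↔ ε x = 0 := Iff.rfl
    have e : H ≃ₗ[Hᵐᵒᵖ] Hᵐᵒᵖ :=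
      { MulOpposite.opAddEquiv with
        map_smul' := fun c x => MulOpposite.unop_injective (by simp) }
    have : IsSemisimpleModule Hᵐᵒᵖ H := IsSemisimpleModule.congr e
    obtain ⟨J, hJ⟩ := exists_isCompl I
    obtain ⟨i, hi, j, hj, hij⟩ := Submodule.mem_sup.1
      (show (1 : H) ∈ I ⊔ J from hJ.sup_eq_top ▸ Submodule.mem_top)
    refine ⟨j, fun x => ?_, ?_⟩
    · have h : j * (x - algebraMap k H (ε x)) ∈ I ⊓ J :=
        ⟨(hI _).2 (by simp), J.smul_mem (MulOpposite.op _) hj⟩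
      rw [hJ.inf_eq_bot, Submodule.mem_bot, mul_sub, sub_eq_zero] at h
      rw [h, Algebra.smul_def, Algebra.commutes]
    · have := congrArg (fun y => ε y) hij
      simpa [(hI i).1 hi] using this
  obtain ⟨t, ht, ht1⟩ := left
  obtain ⟨u, hu, hu1⟩ := right
  -- The product `u * t` equals both `t` and `u`.
  have : u = t := by
    have h1 := ht u
    rw [hu, ht1, hu1, one_smul, one_smul] at h1
    exact h1
  exact ⟨t, ⟨ht, this ▸ hu⟩, ht1⟩

variable (k H) in
/-- The linear form `x ↦ Tr (y ↦ x S²(y))`. -/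
noncomputable def twistedTrace : H →ₗ[k] k :=
  LinearMap.trace k H ∘ₗ LinearMap.lcomp k H (S ∘ₗ S) ∘ₗ LinearMap.mul k H

theorem twistedTrace_apply (x : H) :
    twistedTrace k H x = LinearMap.trace k H (LinearMap.mulLeft k x ∘ₗ S ∘ₗ S) := rfl

/-- Cyclicity of the trace: moving left multiplication by `x` past `S²` replaces it by left
multiplication by `S²(x)`. -/
theorem twistedTrace_mul (x y : H) :
    twistedTrace k H (x * y) = twistedTrace k H (y * S (S x)) := by
  rw [twistedTrace_apply, twistedTrace_apply]
  have h₁ : LinearMap.mulLeft k (x * y) ∘ₗ S ∘ₗ S =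
      LinearMap.mulLeft k x * (LinearMap.mulLeft k y * (S ∘ₗ S)) := by
    ext z
    simp
  have h₂ : LinearMap.mulLeft k (y * S (S x)) ∘ₗ S ∘ₗ S =
      (LinearMap.mulLeft k y * (S ∘ₗ S)) * LinearMap.mulLeft k x := by
    ext z
    simp [antipode_mul_antidistrib]
  rw [h₁, h₂, LinearMap.trace_mul_comm]

theorem sw_comul_antipode_antipode {M : Type*} [AddCommMonoid M] [Module k M] (x : H)
    {F : H → H → M} (h₁ : ∀ b, IsLin k (fun a => F a b)) (h₂ : ∀ a, IsLin k (F a)) :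
    sw (Δ (S (S x))) F = sw (Δ x) (fun a b => F (S (S a)) (S (S b))) := by
  rw [sw_comul_antipode _ h₁ h₂, sw_comul_antipode] <;> intros <;> fun_prop

variable [Module.Finite k H]

theorem twistedTrace_integral {t : H} (ht : IsIntegral k t) : twistedTrace k H t = ε t := by
  have : LinearMap.mulLeft k t ∘ₗ S ∘ₗ S = (Coalgebra.counit (R := k) (A := H)).smulRight t := by
    ext z
    simp [ht.mul_right]
  rw [twistedTrace_apply, this, LinearMap.trace_smulRight]

/-- `∑ λ(x₂) x₁ = λ(x) 1` for the twisted trace `λ`. -/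
theorem sw_twistedTrace (x : H) :
    sw (Δ x) (fun a b => twistedTrace k H b • a) = twistedTrace k H x • (1 : H) := by
  refine (Module.forall_dual_apply_eq_zero_iff k _).1 ?_ |> sub_eq_zero.1
  intro f
  rw [map_sub, sub_eq_zero, map_smul]
  rw [map_sw _ _ (IsLin.linearMap f)]
  -- Paired with `f`, the two sides are the traces of `P` and of `f(1) T`. `trace_sw_sw` compares
  -- them for the coaction `y ↦ y₂ ⊗ y₁` and the form `F(d, c) = f(d S(c))`.
  let T : H →ₗ[k] H := LinearMap.mulLeft k x ∘ₗ S ∘ₗ S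
  let P : H →ₗ[k] H := sw (Δ x) (fun a b => f a • LinearMap.mulLeft k b ∘ₗ S ∘ₗ S)
  have e₁ : sw (Δ x) (fun a b => f (twistedTrace k H b • a)) = LinearMap.trace k H P := by
    rw [map_sw _ _ (IsLin.linearMap _)]
    refine sw_congr fun a b => ?_
    rw [map_smul, map_smul, twistedTrace_apply, smul_eq_mul, smul_eq_mul, mul_comm]
  have e₂ : twistedTrace k H x • f 1 = LinearMap.trace k H (f 1 • T) := by
    rw [map_smul, twistedTrace_apply, smul_eq_mul, smul_eq_mul, mul_comm]
  rw [e₁, e₂]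
  refine trace_sw_sw (k := k) ((TensorProduct.comm k H H).toLinearMap ∘ₗ Coalgebra.comul) T _ _
    (F := fun d c => f (d * S c)) (by intros; fun_prop) (by intros; fun_prop) (fun y => ?_)
    (fun y => ?_)
  · have eT (q : H) : T q = x * S (S q) := rfl
    simp only [LinearMap.comp_apply, LinearEquiv.coe_coe]
    rw [sw_swap _ (by intros; fun_prop) (by intros; fun_prop)]
    calc P y = sw (Δ x) (fun a b => f a • (b * S (S y))) := by
          rw [map_sw (f := fun A : H →ₗ[k] H => A y) _ _ (by fun_prop)]
          rfl
      _ = sw (Δ x) (fun a b => sw (Δ y) (fun p v => ε p • f a • (b * S (S v)))) := by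
          refine sw_congr fun a b => ?_
          rw [sw_comul_counit_left (f := fun v => f a • (b * S (S v))) y (by fun_prop)]
      _ = sw (Δ x) (fun a b => sw (Δ y) (fun p' v => sw (Δ p') (fun p u =>
            f (a * S (S u) * S p) • (b * S (S v))))) := by
          refine sw_congr fun a b => sw_congr fun p' v => ?_
          have := sw_mul_antipode' (k := k) p' (f := fun z => f (a * S z) • (b * S (S v)))
            (by fun_prop)
          simpa [antipode_mul_antidistrib, mul_assoc] using this.symm
      _ = sw (Δ x) (fun a b => sw (Δ y) (fun p q => sw (Δ q) (fun u v =>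
            f (a * S (S u) * S p) • (b * S (S v))))) := by
          refine sw_congr fun a b => ?_
          rw [sw_comul_assoc] <;> intros <;> fun_prop
      _ = sw (Δ y) (fun p q => sw (Δ x) (fun a b => sw (Δ q) (fun u v =>
            f (a * S (S u) * S p) • (b * S (S v))))) := sw_comm _ _ _
      _ = sw (Δ y) (fun p q => sw (Δ (x * S (S q))) (fun r s => f (r * S p) • s)) := by
          refine sw_congr fun p q => ?_
          rw [sw_comul_mul _ _ (by intros; fun_prop) (by intros; fun_prop)]
          refine sw_congr fun a b => ?_
          rw [sw_comul_antipode_antipode] <;> intros <;> fun_prop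
      _ = _ := by
          refine sw_congr fun p q => ?_
          rw [sw_swap _ (by intros; fun_prop) (by intros; fun_prop), eT]
  · simp only [LinearMap.comp_apply, LinearEquiv.coe_coe]
    rw [sw_swap _ (by intros; fun_prop) (by intros; fun_prop)]
    rw [LinearMap.smul_apply, ← map_smul]
    congr 1
    calc f 1 • y = sw (Δ y) (fun p s => ε p • f 1 • s) :=
          (sw_comul_counit_left (f := fun s => f 1 • s) y (by fun_prop)).symm
      _ = sw (Δ y) (fun p' s => sw (Δ p') (fun p r => f (p * S r) • s)) := by
          refine sw_congr fun p' s => ?_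
          rw [sw_mul_antipode' (k := k) p' (f := fun z => f z • s) (by fun_prop)]
      _ = sw (Δ y) (fun p q => sw (Δ q) (fun r s => f (p * S r) • s)) := by
          rw [sw_comul_assoc] <;> intros <;> fun_prop
      _ = _ := by
          refine sw_congr fun p q => ?_
          rw [sw_swap _ (by intros; fun_prop) (by intros; fun_prop)]

end Hopf

/-! ### Frobenius structure, the distinguished group-like element and `S⁴`. -/

section Hopf

variable {k H : Type*} [Field k] [Ring H] [HopfAlgebra k H]

local notation "Δ" => Coalgebra.comul (R := k)
local notation "S" => HopfAlgebra.antipode k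
local notation "ε" => Coalgebra.counit (R := k)

/-- `∑ μ(x b₂) b₁ = ∑ μ(x₂ b) S(x₁)` for an integral `μ` in the dual. -/
theorem sw_integral_mul {μ : H →ₗ[k] k}
    (hμ : ∀ x, sw (Δ x) (fun a b => μ b • a) = μ x • (1 : H)) (x y : H) :
    sw (Δ y) (fun a b => μ (x * b) • a) = sw (Δ x) (fun a b => μ (b * y) • S a) := by
  symm
  calc sw (Δ x) (fun a b => μ (b * y) • S a)
      = sw (Δ x) (fun a b => sw (Δ b) (fun c d => sw (Δ y) (fun e f =>
          μ (d * f) • (S a * c * e)))) := by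
        refine sw_congr fun a b => ?_
        have h := congrArg (fun z => S a * z) (hμ (b * y))
        simp only [mul_smul_comm, mul_one] at h
        rw [← h, sw_comul_mul _ _ (by intros; fun_prop) (by intros; fun_prop),
          map_sw (f := fun z => S a * z) _ _ (by fun_prop)]
        refine sw_congr fun c d => ?_
        rw [map_sw (f := fun z => S a * z) _ _ (by fun_prop)]
        simp [mul_assoc]
    _ = sw (Δ x) (fun p d => sw (Δ p) (fun a c => sw (Δ y) (fun e f =>
          μ (d * f) • (S a * c * e)))) := by
        rw [sw_comul_assoc] <;> intros <;> fun_prop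
    _ = sw (Δ x) (fun p d => ε p • sw (Δ y) (fun e f => μ (d * f) • e)) := by
        refine sw_congr fun p d => ?_
        rw [sw_antipode_mul' (k := k) p
          (f := fun z => sw (Δ y) (fun e f => μ (d * f) • (z * e))) (by fun_prop)]
        simp
    _ = _ := sw_comul_counit_left (f := fun d => sw (Δ y) (fun e f => μ (d * f) • e)) x
        (by fun_prop)

/-- Take `x = t` in `sw_integral_mul`: the integral absorbs `y₂`. When `μ(t) ≠ 0` this recovers `y`
from the functional `μ(· y)`, whence nondegeneracy of `μ` and surjectivity of `S`. -/
theorem sw_comul_isIntegral {t : H} (ht : IsIntegral k t) {μ : H →ₗ[k] k}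
    (hμ : ∀ x, sw (Δ x) (fun a b => μ b • a) = μ x • (1 : H)) (y : H) :
    sw (Δ t) (fun a b => μ (b * y) • S a) = μ t • y := by
  rw [← sw_integral_mul hμ]
  simp only [ht.mul_right, map_smul, smul_eq_mul]
  rw [← sw_comul_counit_right (f := fun y => μ t • y) y (by fun_prop)]
  exact sw_congr fun a b => mul_smul _ _ _

variable [Module.Finite k H]

theorem sw_twistedTrace_mul {t : H} (ht : IsIntegral k t) (h1 : ε t = 1) (y : H) :
    sw (Δ t) (fun a b => twistedTrace k H (b * y) • S a) = y := by
  rw [sw_comul_isIntegral ht sw_twistedTrace, twistedTrace_integral ht, h1, one_smul]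

theorem antipode_bijective {t : H} (ht : IsIntegral k t) (h1 : ε t = 1) :
    Function.Bijective (S : H →ₗ[k] H) := by
  have hs : Function.Surjective (S : H →ₗ[k] H) := fun y =>
    ⟨sw (Δ t) (fun a b => twistedTrace k H (b * y) • a), by
      rw [map_sw (f := S) _ _ (by fun_prop)]
      simpa using sw_twistedTrace_mul ht h1 y⟩
  exact ⟨LinearMap.injective_iff_surjective.2 hs, hs⟩

theorem eq_of_twistedTrace_mul {t : H} (ht : IsIntegral k t) (h1 : ε t = 1) {y z : H}
    (h : ∀ x, twistedTrace k H (x * y) = twistedTrace k H (x * z)) : y = z := by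
  rw [← sw_twistedTrace_mul ht h1 y, ← sw_twistedTrace_mul ht h1 z]
  simp only [h]

theorem antipode_isIntegral {t : H} (ht : IsIntegral k t) (h1 : ε t = 1) : S t = t := by
  have := ht.eq_smul h1 (u := S t) fun x => by
    obtain ⟨x, rfl⟩ := (antipode_bijective ht h1).2 x
    rw [← antipode_mul_antidistrib, ht.mul_right, map_smul, counit_antipode]
  rw [this, counit_antipode, h1, one_smul]

theorem sw_twistedTrace_antipode {t : H} (ht : IsIntegral k t) (h1 : ε t = 1) (x : H) :
    sw (Δ x) (fun a b => twistedTrace k H (S a) • b) = twistedTrace k H (S x) • (1 : H) := by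
  apply (antipode_bijective ht h1).1
  rw [map_sw (f := S) _ _ (by fun_prop), map_smul, antipode_one, ← sw_twistedTrace,
    sw_comul_antipode _ (by intros; fun_prop) (by intros; fun_prop)]
  simp

/-- Uniqueness of integrals in the dual. -/
theorem integral_eq_smul_twistedTrace {t : H} (ht : IsIntegral k t) (h1 : ε t = 1) {μ : H →ₗ[k] k}
    (hμ : ∀ x, sw (Δ x) (fun a b => μ b • a) = μ x • (1 : H)) (y : H) :
    μ y = μ t * twistedTrace k H y := by
  -- The sum `∑ λ(S(t₁)) μ(t₂ y)` is evaluated twice: by applying `λ` to the reconstruction formula,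
  -- and by using `∑ λ(S(t₁)) t₂ = λ(S(t)) 1 = 1`.
  have h := congrArg (twistedTrace k H) (sw_comul_isIntegral ht hμ y)
  rw [map_sw (f := twistedTrace k H) _ _ (by fun_prop), map_smul, smul_eq_mul] at h
  rw [← h]
  have h2 := congrArg (fun z => μ (z * y)) (sw_twistedTrace_antipode ht h1 t)
  rw [map_sw (f := fun z => μ (z * y)) _ _ (by fun_prop), antipode_isIntegral ht h1,
    twistedTrace_integral ht, h1] at h2
  simp only [one_smul, one_mul] at h2
  rw [← h2]
  refine sw_congr fun a b => ?_
  simp [mul_comm]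

/-- The distinguished group-like element. -/
theorem exists_isGroupLikeElem {t : H} (ht : IsIntegral k t) (h1 : ε t = 1) :
    ∃ g : H, IsGroupLikeElem k g ∧
    ∀ x, sw (Δ x) (fun a b => twistedTrace k H a • b) = twistedTrace k H x • g := by
  -- For every form `f`, the functional `x ↦ ∑ λ(x₁) f(x₂)` is again an integral, hence a multiple
  -- of `λ`, with factor its value at `t`. So the witness is `g = ∑ λ(t₁) t₂`.
  have key (x : H) : sw (Δ x) (fun a b => twistedTrace k H a • b) =
      twistedTrace k H x • sw (Δ t) (fun a b => twistedTrace k H a • b) := by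
    refine (Module.forall_dual_apply_eq_zero_iff k _).1 ?_ |> sub_eq_zero.1
    intro f
    have l : IsLin k (fun x : H => f (sw (Δ x) (fun a b => twistedTrace k H a • b))) := by
      fun_prop
    rw [map_sub, sub_eq_zero, map_smul, smul_eq_mul, mul_comm]
    refine integral_eq_smul_twistedTrace ht h1 (μ := l.mk') (fun x => ?_) x
    simp only [IsLin.mk'_apply]
    calc _ = sw (Δ x) (fun a q => sw (Δ q) (fun b c => f c • twistedTrace k H b • a)) := by
          refine sw_congr fun a q => ?_
          rw [map_sw (f := f) _ _ (by fun_prop), map_sw (f := fun z => z • a) _ _ (by fun_prop)]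
          refine sw_congr fun b c => ?_
          rw [map_smul, smul_eq_mul, mul_comm, mul_smul]
      _ = sw (Δ x) (fun p c => sw (Δ p) (fun a b => f c • twistedTrace k H b • a)) := by
          rw [sw_comul_assoc] <;> intros <;> fun_prop
      _ = sw (Δ x) (fun p c => f (twistedTrace k H p • c) • (1 : H)) := by
          refine sw_congr fun p c => ?_
          rw [sw_smul, sw_twistedTrace, map_smul, smul_eq_mul, mul_comm, mul_smul, smul_comm]
      _ = _ := by
          rw [map_sw (f := f) _ _ (by fun_prop),
            map_sw (f := fun z => z • (1 : H)) _ _ (by fun_prop)]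
  refine ⟨_, ⟨?_, ?_⟩, key⟩
  · rw [map_sw (f := ε) _ _ (by fun_prop)]
    have := sw_comul_counit_right (k := k) (f := twistedTrace k H) t (by fun_prop)
    simp only [map_smul, smul_eq_mul] at this ⊢
    simp only [mul_comm, this, twistedTrace_integral ht, h1]
  · rw [map_sw (f := Δ) _ _ (by fun_prop)]
    calc _ = sw (Δ t) (fun a q => sw (Δ q) (fun b c => (twistedTrace k H a • b) ⊗ₜ[k] c)) := by
          refine sw_congr fun a q => ?_
          rw [map_smul]
          conv_lhs => rw [← sw_tmul_self (Δ q)]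
          rw [← sw_smul]
          rfl
      _ = sw (Δ t) (fun p c => sw (Δ p) (fun a b => (twistedTrace k H a • b) ⊗ₜ[k] c)) := by
          rw [sw_comul_assoc] <;> intros <;> fun_prop
      _ = sw (Δ t) (fun p c => sw (Δ t) (fun a b => twistedTrace k H a • b) ⊗ₜ[k]
            (twistedTrace k H p • c)) := by
          refine sw_congr fun p c => ?_
          rw [← map_sw (f := fun z => z ⊗ₜ[k] c) _ _ (by fun_prop), key p,
            TensorProduct.smul_tmul]
      _ = _ := by
          rw [← map_sw (f := fun z => sw (Δ t) (fun a b => twistedTrace k H a • b) ⊗ₜ[k] z) _ _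
            (by fun_prop)]

/-- Both `λ ∘ S` and `λ(· g)` are integrals of the opposite handedness. Composed with `S`, each is a
multiple of `λ`, and the factors agree since `S(t) = t = t g`. -/
theorem twistedTrace_antipode {t : H} (ht : IsIntegral k t) (h1 : ε t = 1) {g : H}
    (hg : IsGroupLikeElem k g)
    (hx : ∀ x, sw (Δ x) (fun a b => twistedTrace k H a • b) = twistedTrace k H x • g) (x : H) :
    twistedTrace k H (S x) = twistedTrace k H (x * g) := by
  have key {ν : H →ₗ[k] k} (hν : ∀ x, sw (Δ x) (fun a b => ν a • b) = ν x • (1 : H)) (x : H) :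
      ν (S x) = ν t * twistedTrace k H x := by
    have := integral_eq_smul_twistedTrace ht h1 (μ := ν ∘ₗ S) (fun x => by
      apply (antipode_bijective ht h1).1
      rw [map_sw (f := S) _ _ (by fun_prop), map_smul, antipode_one, LinearMap.comp_apply, ← hν,
        sw_comul_antipode _ (by intros; fun_prop) (by intros; fun_prop)]
      simp) x
    simpa [antipode_isIntegral ht h1] using this
  obtain ⟨x, rfl⟩ := (antipode_bijective ht h1).2 x
  have a₁ := key (ν := twistedTrace k H ∘ₗ S) (sw_twistedTrace_antipode ht h1) x
  have a₂ := key (ν := twistedTrace k H ∘ₗ LinearMap.mulRight k g) (fun x => by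
    have h : sw (Δ x) (fun a b => twistedTrace k H (a * g) • b) * g =
        twistedTrace k H (x * g) • (1 : H) * g := by
      rw [map_sw (f := fun z => z * g) _ _ (by fun_prop), smul_mul_assoc, one_mul, ← hx,
        Bialgebra.comul_mul, hg.comul_eq_tmul_self,
        sw_mul _ _ ⟨by intros; fun_prop, by intros; fun_prop⟩]
      refine sw_congr fun a b => ?_
      rw [sw_tmul _ _ ⟨by intros; fun_prop, by intros; fun_prop⟩, smul_mul_assoc]
    exact hg.isUnit.mul_right_cancel h) x
  simp only [LinearMap.comp_apply, LinearMap.mulRight_apply, ht.mul_right,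
    hg.counit_eq_one, one_smul, antipode_isIntegral ht h1] at a₁ a₂
  rw [a₁, a₂]

/-- The fourth power of the antipode of a unimodular Hopf algebra is inner. -/
theorem antipode_pow_four {t : H} (ht : IsIntegral k t) (h1 : ε t = 1) {g : H}
    (hg : IsGroupLikeElem k g)
    (hx : ∀ x, sw (Δ x) (fun a b => twistedTrace k H a • b) = twistedTrace k H x • g) (y : H) :
    y * g = g * S (S (S (S y))) := by
  refine eq_of_twistedTrace_mul ht h1 fun x => ?_
  have e := twistedTrace_antipode ht h1 hg hx
  -- The chain is `λ(xyg) = λ(S(y)S(x)) = λ(S(x)S³(y)) = λ(S(S²(y)x)) = λ(S²(y)xg) = λ(xgS⁴(y))`.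
  rw [← mul_assoc, ← e, antipode_mul_antidistrib, twistedTrace_mul, ← antipode_mul_antidistrib, e,
    mul_assoc, twistedTrace_mul, mul_assoc]

/-- Group-like elements are linearly independent, so there are finitely many and `g ^ n = 1` for
some `n > 0`; iterating `antipode_pow_four` then gives `S^(4n) = 1`. -/
theorem exists_pow_antipode_eq_one {t : H} (ht : IsIntegral k t) (h1 : ε t = 1) :
    ∃ N, 0 < N ∧ (S ∘ₗ S : Module.End k H) ^ N = 1 := by
  obtain ⟨g, hg, hx⟩ := exists_isGroupLikeElem ht h1
  have : Finite (GroupLike k H) := (linearIndep_groupLikeVal (R := k) (A := H)).finite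
  obtain ⟨n, hn, hgn⟩ := isOfFinOrder_iff_pow_eq_one.1
    (isOfFinOrder_of_finite (⟨g, hg⟩ : GroupLike k H))
  have hgn : g ^ n = 1 := by simpa using congrArg GroupLike.val hgn
  refine ⟨2 * n, by omega, ?_⟩
  have h (m : ℕ) (y : H) : y * g ^ m = g ^ m * ((S ∘ₗ S : Module.End k H) ^ (2 * m)) y := by
    induction m generalizing y with
    | zero => simp
    | succ m ih =>
      rw [pow_succ, ← mul_assoc, ih, mul_assoc, antipode_pow_four ht h1 hg hx, ← mul_assoc, mul_add,
        Nat.add_comm, pow_add]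
      rfl
  ext y
  simpa [hgn] using (h n y).symm

end Hopf

/-! ### Positivity of traces of finite-order automorphisms. -/

section FiniteOrder

variable {K : Type*} [Field K] [CharZero K]

/-- In characteristic zero `X ^ M - 1` is separable, so `f` is diagonalizable; `a μ` is the
multiplicity of the eigenvalue `μ`. -/
theorem exists_trace_pow_eq_sum [IsAlgClosed K] {V : Type*} [AddCommGroup V] [Module K V]
    [FiniteDimensional K V] (f : Module.End K V) {M : ℕ} (hM : 0 < M) (hf : f ^ M = 1) :
    ∃ (s : Finset K) (a : K → ℕ), (∀ μ ∈ s, μ ^ M = 1) ∧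
      ∀ j, LinearMap.trace K V (f ^ j) = ∑ μ ∈ s, (a μ : K) * μ ^ j := by
  classical
  have hs : f.IsSemisimple := by
    have hM' : (M : K) ≠ 0 := by exact_mod_cast hM.ne'
    refine Module.End.isSemisimple_of_squarefree_aeval_eq_zero
      (p := Polynomial.X ^ M - 1) (Polynomial.X_pow_sub_one_separable_iff.2 hM').squarefree ?_
    simp [hf]
  have hint : DirectSum.IsInternal f.eigenspace :=
    DirectSum.isInternal_submodule_of_iSupIndep_of_iSup_eq_top f.eigenspaces_iSupIndep
      hs.iSup_eigenspace_eq_top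
  have hfin : {μ | f.eigenspace μ ≠ ⊥}.Finite :=
    WellFoundedGT.finite_ne_bot_of_iSupIndep f.eigenspaces_iSupIndep
  have hpow (μ : K) (j : ℕ) (x : V) (hx : f x = μ • x) : (f ^ j) x = μ ^ j • x := by
    induction j with
    | zero => simp
    | succ j ih => rw [pow_succ, Module.End.mul_apply, hx, map_smul, ih, smul_smul, pow_succ']
  refine ⟨hfin.toFinset, fun μ => Module.finrank K (f.eigenspace μ), fun μ hμ => ?_, fun j => ?_⟩
  · obtain ⟨x, hx, hx0⟩ := (Submodule.ne_bot_iff _).1 (hfin.mem_toFinset.1 hμ)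
    have := hpow μ M x (Module.End.mem_eigenspace_iff.1 hx)
    rw [hf, Module.End.one_apply] at this
    have h : (μ ^ M - 1) • x = 0 := by rw [sub_smul, ← this, one_smul, sub_self]
    exact sub_eq_zero.1 ((smul_eq_zero.1 h).resolve_right hx0)
  · have hmaps (μ : K) : Set.MapsTo (f ^ j) (f.eigenspace μ) (f.eigenspace μ) := fun x hx => by
      have hx' := hpow μ j x (Module.End.mem_eigenspace_iff.1 hx)
      rw [hx']
      exact Submodule.smul_mem _ _ hx
    rw [LinearMap.trace_eq_sum_trace_restrict' hint hfin hmaps]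
    refine Finset.sum_congr rfl fun μ _ => ?_
    have : (f ^ j).restrict (hmaps μ) = μ ^ j • (1 : Module.End K (f.eigenspace μ)) := by
      ext x
      exact hpow μ j x (Module.End.mem_eigenspace_iff.1 x.2)
    rw [this, map_smul, LinearMap.trace_one, smul_eq_mul, mul_comm]

/-- `x` is algebraic over `ℚ` and `φ` sends it to a non-negative real number. -/
def IsNonnegVia (φ : algebraicClosure ℚ K →+* ℂ) (x : K) : Prop :=
  ∃ (y : algebraicClosure ℚ K) (r : ℝ), (y : K) = x ∧ 0 ≤ r ∧ φ y = r

theorem IsNonnegVia.zero (φ : algebraicClosure ℚ K →+* ℂ) : IsNonnegVia φ 0 :=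
  ⟨0, 0, by simp⟩

theorem IsNonnegVia.sum {φ : algebraicClosure ℚ K →+* ℂ} {ι : Type*} (s : Finset ι) {x : ι → K}
    (h : ∀ i ∈ s, IsNonnegVia φ (x i)) : IsNonnegVia φ (∑ i ∈ s, x i) := by
  classical
  induction s using Finset.induction_on with
  | empty => simpa using IsNonnegVia.zero φ
  | insert i s hi ih =>
    rw [Finset.sum_insert hi]
    obtain ⟨y, r, hy', hr, hy⟩ := h i (Finset.mem_insert_self _ _)
    obtain ⟨z, t, hz, ht, hz'⟩ := ih fun j hj => h j (Finset.mem_insert_of_mem hj)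
    exact ⟨y + z, r + t, by simp [hz, hy'], by positivity, by simp [hy, hz']⟩

theorem IsNonnegVia.one_add_ne_zero {φ : algebraicClosure ℚ K →+* ℂ} {x : K}
    (h : IsNonnegVia φ x) : 1 + x ≠ 0 := by
  obtain ⟨y, r, rfl, hr, hy⟩ := h
  intro h0
  have h1 : (1 : algebraicClosure ℚ K) + y = 0 := Subtype.ext (by simpa using h0)
  have h2 := congrArg φ h1
  rw [map_add, map_one, hy, map_zero] at h2
  have h3 : (1 : ℝ) + r = 0 := by exact_mod_cast h2
  linarith

/-- Roots of unity have absolute value `1` in `ℂ`, so `μ ^ (M - 1) = μ⁻¹` becomes the complex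
conjugate of `μ`, and the product becomes `|w|²`. -/
theorem isNonnegVia_mul (φ : algebraicClosure ℚ K →+* ℂ) {M : ℕ} (hM : 0 < M) (s : Finset K)
    (a : K → ℕ) (hs : ∀ μ ∈ s, μ ^ M = 1) :
    IsNonnegVia φ ((∑ μ ∈ s, (a μ : K) * μ ^ 1) * ∑ μ ∈ s, (a μ : K) * μ ^ (M - 1)) := by
  have hmem (μ : s) : (μ : K) ∈ algebraicClosure ℚ K := by
    rw [mem_algebraicClosure_iff]
    exact (IsIntegral.of_pow hM (by rw [hs _ μ.2]; exact isIntegral_one)).isAlgebraic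
  let z : s → algebraicClosure ℚ K := fun μ => ⟨μ, hmem μ⟩
  have hz (μ : s) : φ (z μ) ^ M = 1 := by
    rw [← map_pow, show z μ ^ M = 1 from Subtype.ext (hs _ μ.2), map_one]
  have hconj (μ : s) : φ (z μ) ^ (M - 1) = (starRingEnd ℂ) (φ (z μ)) := by
    have hn : ‖φ (z μ)‖ = 1 := Complex.norm_eq_one_of_pow_eq_one (hz μ) hM.ne'
    rw [← Complex.inv_eq_conj hn]
    refine eq_inv_of_mul_eq_one_left ?_
    rw [← pow_succ, Nat.sub_add_cancel hM, hz]
  let w : ℂ := ∑ μ : s, (a μ : ℂ) * φ (z μ)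
  refine ⟨(∑ μ : s, (a μ : algebraicClosure ℚ K) * z μ ^ 1) *
      ∑ μ : s, (a μ : algebraicClosure ℚ K) * z μ ^ (M - 1),
    Complex.normSq w, ?_, Complex.normSq_nonneg _, ?_⟩
  · rw [← Finset.sum_coe_sort s, ← Finset.sum_coe_sort s]
    push_cast
    simp [z]
  · rw [← Complex.mul_conj]
    simp [hconj, w]

omit [CharZero K] in
-- Skolem-Noether for a matrix algebra.
theorem exists_conj_of_algEquiv_matrix {n : Type*} [Fintype n] [DecidableEq n]
    (φ : Matrix n n K ≃ₐ[K] Matrix n n K) :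
    ∃ A B : Matrix n n K, A * B = 1 ∧ B * A = 1 ∧ ∀ X, φ X = A * X * B := by
  obtain ⟨T, hT⟩ := AlgEquiv.eq_linearEquivConjAlgEquiv
    ((Matrix.toLinAlgEquiv' (R := K) (n := n)).symm.trans (φ.trans Matrix.toLinAlgEquiv'))
  refine ⟨LinearMap.toMatrix' T.toLinearMap, LinearMap.toMatrix' T.symm.toLinearMap, ?_, ?_,
    fun X => ?_⟩
  · rw [← LinearMap.toMatrix'_comp, LinearEquiv.comp_coe]; simp
  · rw [← LinearMap.toMatrix'_comp, LinearEquiv.comp_coe]; simp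
  · have h := congrArg (fun e => Matrix.toLinAlgEquiv'.symm (e (Matrix.toLinAlgEquiv' X))) hT
    simp only [AlgEquiv.trans_apply, AlgEquiv.symm_apply_apply] at h
    rw [h]
    have e : (LinearEquiv.conjAlgEquiv K T) (Matrix.toLinAlgEquiv' X) =
        T.toLinearMap ∘ₗ Matrix.toLin' X ∘ₗ T.symm.toLinearMap := rfl
    rw [e]
    change LinearMap.toMatrix' (T.toLinearMap ∘ₗ Matrix.toLin' X ∘ₗ T.symm.toLinearMap) = _
    rw [LinearMap.toMatrix'_comp, LinearMap.toMatrix'_comp, LinearMap.toMatrix'_toLin', mul_assoc]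

omit [CharZero K] in
theorem trace_mul_mul {n : Type*} [Fintype n] [DecidableEq n] (A B : Matrix n n K)
    (f : Module.End K (Matrix n n K)) (hf : ∀ X, f X = A * X * B) :
    LinearMap.trace K _ f = A.trace * B.trace := by
  rw [LinearMap.trace_eq_matrix_trace K (Matrix.stdBasis K n n)]
  rw [Matrix.trace, Matrix.trace, Matrix.trace, Finset.sum_mul_sum, Fintype.sum_prod_type]
  refine Finset.sum_congr rfl fun i _ => Finset.sum_congr rfl fun j _ => ?_
  rw [Matrix.diag_apply, LinearMap.toMatrix_apply, hf, Matrix.stdBasis_eq_single]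
  have : (Matrix.stdBasis K n n).repr (A * Matrix.single i j 1 * B) (i, j) =
    (A * Matrix.single i j 1 * B : Matrix n n K) i j := rfl
  rw [this]
  simp [Matrix.mul_apply, Matrix.single_apply, ite_and]

end FiniteOrder

section FiniteOrder

variable {K : Type*} [Field K] [CharZero K] [IsAlgClosed K]

/-- The automorphism is conjugation by some `A`, and `A ^ M` is central, hence a scalar `c`.
Dividing `A` by an `M`-th root of `c` gives `A ^ M = 1`, so the trace is `tr(A) tr(A ^ (M - 1))`. -/
theorem isNonnegVia_trace_matrix (φ : algebraicClosure ℚ K →+* ℂ) {n : Type*} [Fintype n]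
    [DecidableEq n] [Nonempty n] (f : Matrix n n K ≃ₐ[K] Matrix n n K) {M : ℕ} (hM : 0 < M)
    (hf : ∀ X, f^[M] X = X) : IsNonnegVia φ (LinearMap.trace K _ f.toLinearMap) := by
  obtain ⟨A, B, hAB, hBA, h⟩ := exists_conj_of_algEquiv_matrix f
  have hpow (j : ℕ) (X) : f^[j] X = A ^ j * X * B ^ j := by
    induction j with
    | zero => simp
    | succ j ih =>
      rw [Function.iterate_succ_apply', ih, h, pow_succ', pow_succ]
      simp only [mul_assoc]
  have hBA' : B ^ M * A ^ M = 1 := by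
    rw [← (show Commute B A from hBA.trans hAB.symm).mul_pow, hBA, one_pow]
  obtain ⟨c, hc⟩ : A ^ M ∈ Set.range (Matrix.scalar n) := by
    refine Matrix.mem_range_scalar_of_commute_single fun i j _ => ?_
    have e := hpow M (Matrix.single i j 1)
    rw [hf] at e
    change Matrix.single i j 1 * A ^ M = A ^ M * Matrix.single i j 1
    nth_rewrite 1 [e]
    rw [mul_assoc, hBA', mul_one]
  have hc0 : c ≠ 0 := by
    rintro rfl
    rw [map_zero] at hc
    rw [← hc, mul_zero] at hBA'
    exact zero_ne_one hBA'
  obtain ⟨d, hd⟩ := IsAlgClosed.exists_pow_nat_eq c hM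
  have hd0 : d ≠ 0 := by
    rintro rfl
    rw [zero_pow hM.ne'] at hd
    exact hc0 hd.symm
  have hA : (d⁻¹ • A) ^ M = 1 := by
    rw [smul_pow, ← hc, ← hd, inv_pow, Matrix.scalar_apply, ← Matrix.smul_one_eq_diagonal,
      smul_smul, inv_mul_cancel₀ (pow_ne_zero _ hd0), one_smul]
  have hB : d • B = (d⁻¹ • A) ^ (M - 1) := by
    have h1 : (d⁻¹ • A) * (d • B) = 1 := by
      rw [smul_mul_smul_comm, inv_mul_cancel₀ hd0, one_smul, hAB]
    calc d • B = ((d⁻¹ • A) ^ (M - 1) * (d⁻¹ • A)) * (d • B) := by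
          rw [← pow_succ, Nat.sub_add_cancel hM, hA, one_mul]
      _ = _ := by rw [mul_assoc, h1, mul_one]
  have htr : LinearMap.trace K _ f.toLinearMap =
      ((d⁻¹ • A) ^ 1).trace * ((d⁻¹ • A) ^ (M - 1)).trace := by
    rw [← hB, pow_one]
    refine trace_mul_mul _ _ _ fun X => ?_
    rw [AlgEquiv.toLinearMap_apply, h, smul_mul_assoc, smul_mul_assoc, mul_smul_comm, smul_smul,
      inv_mul_cancel₀ hd0, one_smul]
  obtain ⟨s, a, hs, ha⟩ := exists_trace_pow_eq_sum (Matrix.toLin' (d⁻¹ • A)) hM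
    (by rw [← Matrix.toLin'_pow, hA, Matrix.toLin'_one]; rfl)
  have ha' (j : ℕ) : ((d⁻¹ • A) ^ j).trace = ∑ μ ∈ s, (a μ : K) * μ ^ j := by
    rw [← ha, ← Matrix.toLin'_pow, Matrix.trace_toLin'_eq]
  rw [htr, ha', ha']
  exact isNonnegVia_mul φ hM s a hs

/-- Only the matrix blocks of `H` that `σ` preserves and on which the central idempotent `s` acts as
`1` contribute to the trace; there the matrix case applies. -/
theorem isNonnegVia_trace (φ : algebraicClosure ℚ K →+* ℂ) {H : Type*} [Ring H] [Algebra K H]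
    [FiniteDimensional K H] [IsSemisimpleRing H] (σ : H ≃ₐ[K] H) {M : ℕ} (hM : 0 < M)
    (hσ : ∀ x, σ^[M] x = x) (s : H) (hs : s * s = s) (hsc : ∀ x, s * x = x * s) :
    IsNonnegVia φ (LinearMap.trace K H (σ.toLinearMap ∘ₗ LinearMap.mulLeft K s)) := by
  obtain ⟨n, d, hd, ⟨e⟩⟩ := IsSemisimpleRing.exists_algEquiv_pi_matrix_of_isAlgClosed K H
  let ι (i : Fin n) : Matrix (Fin (d i)) (Fin (d i)) K →ₗ[K] H :=
    e.symm.toLinearMap ∘ₗ LinearMap.single K (fun i => Matrix (Fin (d i)) (Fin (d i)) K) i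
  let π (i : Fin n) : H →ₗ[K] Matrix (Fin (d i)) (Fin (d i)) K :=
    LinearMap.proj i ∘ₗ e.toLinearMap
  have hι (i X) : ι i X = e.symm (Pi.single i X) := rfl
  have hπ (i x) : π i x = e x i := rfl
  have hπι (i X) : π i (ι i X) = X := by simp [hι, hπ]
  have hιmul (i X Y) : ι i (X * Y) = ι i X * ι i Y := by
    rw [hι, hι, hι, ← map_mul, Pi.single_mul]
  have hπmul (i x y) : π i (x * y) = π i x * π i y := by simp [hπ]
  have hιπ (i x) : ι i 1 * x = ι i (π i x) := by
    apply e.injective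
    ext1 j
    rcases eq_or_ne j i with rfl | hj
    · simp [hι, hπ]
    · simp [hι, hπ, hj]
  have hπι' (i x) : x * ι i 1 = ι i (π i x) := by
    apply e.injective
    ext1 j
    rcases eq_or_ne j i with rfl | hj
    · simp [hι, hπ]
    · simp [hι, hπ, hj]
  have hscalar (i : Fin n) (z : H) (hz : z * z = z) (hzc : ∀ x, z * x = x * z) :
      π i z = 0 ∨ π i z = 1 := by
    have := hd i
    obtain ⟨c, hc⟩ : π i z ∈ Set.range (Matrix.scalar (Fin (d i))) := by
      refine Matrix.mem_range_scalar_of_commute_single fun a b _ => ?_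
      have h := congrArg (π i) (hzc (ι i (Matrix.single a b 1)))
      rw [hπmul, hπmul, hπι] at h
      exact h.symm
    have h := congrArg (π i) hz
    rw [hπmul, ← hc, ← map_mul] at h
    have hcc : c * c = c := Matrix.scalar_inj.1 h
    rcases IsIdempotentElem.iff_eq_zero_or_one.1 hcc with h0 | h0
    · left; rw [← hc, h0, map_zero]
    · right; rw [← hc, h0, map_one]
  have htr (f : H →ₗ[K] H) : LinearMap.trace K H f =
      ∑ i, LinearMap.trace K _ (π i ∘ₗ f ∘ₗ ι i) := by
    have hid : f = ∑ i, (f ∘ₗ ι i) ∘ₗ π i := by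
      ext x
      rw [LinearMap.sum_apply]
      simp only [LinearMap.comp_apply]
      rw [← map_sum]
      congr 1
      apply e.injective
      simp only [map_sum, hι, hπ, AlgEquiv.apply_symm_apply]
      exact (Finset.univ_sum_single (e x)).symm
    conv_lhs => rw [hid]
    rw [map_sum]
    exact Finset.sum_congr rfl fun i _ => LinearMap.trace_comp_comm' _ _
  rw [htr]
  refine IsNonnegVia.sum _ fun i _ => ?_
  have := hd i
  rcases hscalar i s hs hsc with h0 | h1
  · have : π i ∘ₗ (σ.toLinearMap ∘ₗ LinearMap.mulLeft K s) ∘ₗ ι i = 0 := by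
      ext1 X
      have : s * ι i X = 0 := by
        rw [← mul_one X, ← one_mul (X * 1), hιmul, ← mul_assoc, hπι', h0]
        simp
      simp [this]
    rw [this, map_zero]
    exact IsNonnegVia.zero φ
  have hs' (X) : s * ι i X = ι i X := by
    rw [← one_mul X, hιmul, ← mul_assoc, hπι', h1]
  have hE1 : ι i 1 * ι i 1 = ι i 1 := by rw [← hιmul, one_mul]
  have hEc (x) : ι i 1 * x = x * ι i 1 := by rw [hιπ, hπι']
  rcases hscalar i (σ (ι i 1)) (by rw [← map_mul, hE1]) (fun x => by
    obtain ⟨x, rfl⟩ := σ.surjective x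
    rw [← map_mul, ← map_mul, hEc]) with h0 | h1
  · have : π i ∘ₗ (σ.toLinearMap ∘ₗ LinearMap.mulLeft K s) ∘ₗ ι i = 0 := by
      ext1 X
      simp only [LinearMap.comp_apply, LinearMap.mulLeft_apply, hs', AlgEquiv.toLinearMap_apply]
      rw [← one_mul X, hιmul, map_mul, hπmul, h0, zero_mul]
      rfl
    rw [this, map_zero]
    exact IsNonnegVia.zero φ
  -- For the block idempotent `e` this says `e ≤ σ(e)`. Iterating up to the period `M` gives
  -- equality, so `σ` preserves the block.
  have hE2 : ι i 1 * σ (ι i 1) = ι i 1 := by rw [hιπ, h1]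
  have hE3 (j : ℕ) : ι i 1 * σ^[j] (ι i 1) = ι i 1 := by
    induction j with
    | zero => exact hE1
    | succ j ih =>
      have := congrArg (σ^[j]) hE2
      have hm (x y : H) : σ^[j] (x * y) = σ^[j] x * σ^[j] y := iterate_map_mul σ j x y
      rw [hm, ← Function.iterate_succ_apply] at this
      calc ι i 1 * σ^[j + 1] (ι i 1) = ι i 1 * σ^[j] (ι i 1) * σ^[j + 1] (ι i 1) := by rw [ih]
        _ = _ := by rw [mul_assoc, this, ih]
  have hE4 : σ (ι i 1) = ι i 1 := by
    have h := congrArg σ (hE3 (M - 1))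
    rw [map_mul, ← Function.iterate_succ_apply' σ, Nat.succ_eq_add_one, Nat.sub_add_cancel hM, hσ,
      ← hEc, hE2] at h
    exact h.symm
  have hσι (X) : σ (ι i X) = ι i (π i (σ (ι i X))) := by
    conv_lhs => rw [← one_mul X, hιmul, map_mul, hE4, hιπ]
  have hiter (j : ℕ) (X) : (fun X => π i (σ (ι i X)))^[j] X = π i (σ^[j] (ι i X)) := by
    induction j generalizing X with
    | zero => exact (hπι i X).symm
    | succ j ih => rw [Function.iterate_succ_apply, ih, ← hσι, Function.iterate_succ_apply]
  let f : Matrix (Fin (d i)) (Fin (d i)) K →ₐ[K] Matrix (Fin (d i)) (Fin (d i)) K :=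
    AlgHom.ofLinearMap (π i ∘ₗ σ.toLinearMap ∘ₗ ι i) (by simpa using h1)
      (fun X Y => by simp [hιmul, hπmul])
  have hf (X) : f^[M] X = X := by
    have := hiter M X
    rw [hσ, hπι] at this
    exact this
  have hfb : Function.Bijective f := by
    obtain ⟨m, rfl⟩ : ∃ m, M = m + 1 := ⟨M - 1, (Nat.sub_add_cancel hM).symm⟩
    refine ⟨fun X Y h => ?_, fun X => ⟨f^[m] X, ?_⟩⟩
    · rw [← hf X, ← hf Y, Function.iterate_succ_apply, Function.iterate_succ_apply, h]
    · rw [← Function.iterate_succ_apply' f, hf]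
  have key := isNonnegVia_trace_matrix φ (AlgEquiv.ofBijective f hfb) hM hf
  convert key using 2
  ext1 X
  change π i (σ (s * ι i X)) = π i (σ (ι i X))
  rw [hs']

omit [IsAlgClosed K] in
theorem exists_ringHom_complex : Nonempty (algebraicClosure ℚ K →+* ℂ) :=
  have : Algebra.IsAlgebraic ℚ (algebraicClosure ℚ K) := algebraicClosure.isAlgebraic ℚ K
  ⟨(IsAlgClosed.lift : algebraicClosure ℚ K →ₐ[ℚ] ℂ).toRingHom⟩

end FiniteOrder

/-! ### An integrality criterion for an involution. -/

theorem exists_trace_eq_natCast {K V : Type*} [Field K] [AddCommGroup V] [Module K V]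
    [FiniteDimensional K V] {e : Module.End K V} (he : IsIdempotentElem e) :
    ∃ a : ℕ, a ≤ Module.finrank K V ∧ LinearMap.trace K V e = a :=
  ⟨_, Submodule.finrank_le _, (LinearMap.IsIdempotentElem.isProj_range e he).trace⟩

/-- An involution `σ` commuting with `P`, where `P² = (dim V) P` and `Tr (σ P) = Tr σ ≠ 0`,
is `± 1`. -/
theorem eq_one_of_trace_mul_eq {K V : Type*} [Field K] [CharZero K] [AddCommGroup V] [Module K V]
    [FiniteDimensional K V] {σ P : Module.End K V} (hσ : σ * σ = 1)
    (hP : P * P = (Module.finrank K V : K) • P) (hσP : σ * P = P * σ)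
    (htr : LinearMap.trace K V (σ * P) = LinearMap.trace K V σ)
    (h0 : LinearMap.trace K V σ ≠ 0) {v : V} (hv : v ≠ 0) (hσv : σ v = v) : σ = 1 := by
  have : Nontrivial V := ⟨v, 0, hv⟩
  set n := Module.finrank K V with hn
  have hn0 : (n : K) ≠ 0 := by exact_mod_cast (Module.finrank_pos (R := K) (M := V)).ne'
  have h2 : (2 : K) ≠ 0 := two_ne_zero
  -- `e` and `q` are commuting idempotents, so the traces `a`, `b`, `r` of `q e`, `e`, `q` are
  -- natural numbers.
  let e : Module.End K V := (n : K)⁻¹ • P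
  let q : Module.End K V := (2 : K)⁻¹ • (1 + σ)
  have hPe : P = (n : K) • e := by simp [e, smul_smul, hn0]
  have hσq : σ = (2 : K) • q - 1 := by simp [q, smul_smul]
  have he : IsIdempotentElem e := by
    change e * e = e
    simp only [e, smul_mul_smul_comm, hP, smul_smul]
    congr 1
    field_simp
  have hq : IsIdempotentElem q := by
    change q * q = q
    simp only [q, smul_mul_smul_comm, mul_add, add_mul, one_mul, mul_one, hσ]
    rw [show (1 : Module.End K V) + σ + (σ + 1) = (2 : K) • (1 + σ) by rw [two_smul]; abel,
      smul_smul]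
    congr 1
    field_simp
  have hqe : Commute q e := by
    change q * e = e * q
    simp only [q, e, smul_mul_smul_comm, mul_add, add_mul, one_mul, mul_one, hσP, mul_comm]
  obtain ⟨a, -, ha⟩ := exists_trace_eq_natCast (hq.mul_of_commute hqe he)
  obtain ⟨b, -, hb⟩ := exists_trace_eq_natCast he
  obtain ⟨r, hrn, hr⟩ := exists_trace_eq_natCast hq
  have t₁ : LinearMap.trace K V σ = 2 * r - n := by
    rw [hσq, map_sub, map_smul, hr, LinearMap.trace_one, smul_eq_mul]
  have t₂ : LinearMap.trace K V (σ * P) = n * (2 * a - b) := by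
    rw [hPe, hσq, sub_mul, one_mul, smul_mul_smul_comm, map_sub, map_smul, map_smul, ha, hb,
      smul_eq_mul, smul_eq_mul]
    ring
  have hz : (n : ℤ) * (2 * a - b) = 2 * r - n := by
    rw [t₁, t₂] at htr
    exact_mod_cast htr
  have hz0 : (2 * r - n : ℤ) ≠ 0 := by
    intro h
    apply h0
    rw [t₁]
    exact_mod_cast congrArg (Int.cast : ℤ → K) h
  -- `n` divides the nonzero integer `2r - n`, whose absolute value is at most `n` because `r ≤ n`.
  have hr' : r = 0 ∨ r = n := by
    have hle := Int.le_of_dvd (abs_pos.2 hz0) ((dvd_abs _ _).2 (Dvd.intro _ hz))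
    rcases le_abs.1 hle with h | h <;> omega
  rcases hr' with h | h
  · have : q = 0 := LinearMap.IsIdempotentElem.eq_zero_of_trace_eq_zero hq (by rw [hr, h]; simp)
    exfalso
    rw [this] at hσq
    have hv' : σ v = -v := by rw [hσq]; simp
    rw [hσv, eq_neg_iff_add_eq_zero, ← two_smul K] at hv'
    exact hv ((smul_eq_zero.1 hv').resolve_left h2)
  · have : 1 - q = 0 := LinearMap.IsIdempotentElem.eq_zero_of_trace_eq_zero hq.one_sub
      (by rw [map_sub, hr, h, LinearMap.trace_one, sub_self])
    rw [hσq, ← sub_eq_zero.1 this, two_smul, add_sub_cancel_right]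

/-! ### Maschke's theorem and `S⁴ = 1`. -/

section Hopf

variable {k H : Type*} [Field k] [Ring H] [HopfAlgebra k H]

local notation "Δ" => Coalgebra.comul (R := k)
local notation "S" => HopfAlgebra.antipode k
local notation "ε" => Coalgebra.counit (R := k)

/-- `∑ t₁ ⊗ S(t₂)` is a Casimir element: expand `∑ ε(h₁) t ⊗ h₂` by `ε(h₁) t = h₁ t`, then cancel
`S(h₂) h₃`. -/
theorem IsIntegral.sw_mul_antipode {t : H} (ht : IsIntegral k t) {M : Type*} [AddCommMonoid M]
    [Module k M] {G : H → H → M} (h₁ : ∀ b, IsLin k (fun a => G a b)) (h₂ : ∀ a, IsLin k (G a))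
    (h : H) :
    sw (Δ t) (fun a b => G (h * a) (S b)) = sw (Δ t) (fun a b => G a (S b * h)) := by
  symm
  calc sw (Δ t) (fun a b => G a (S b * h))
      = sw (Δ h) (fun p h₃ => ε p • sw (Δ t) (fun a b => G a (S b * h₃))) :=
        (sw_comul_counit_left (f := fun h => sw (Δ t) (fun a b => G a (S b * h))) h
          (by fun_prop)).symm
    _ = sw (Δ h) (fun p h₃ => sw (Δ (p * t)) (fun a b => G a (S b * h₃))) := by
        refine sw_congr fun p h₃ => ?_
        rw [ht.mul_left]
        exact ((show IsLin k (fun t => sw (Δ t) (fun a b => G a (S b * h₃))) by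
          fun_prop).map_smul _ _).symm
    _ = sw (Δ h) (fun p h₃ => sw (Δ p) (fun h₁ h₂ => sw (Δ t) (fun a b =>
          G (h₁ * a) (S b * (S h₂ * h₃))))) := by
        refine sw_congr fun p h₃ => ?_
        rw [sw_comul_mul _ _ (by intros; fun_prop) (by intros; fun_prop)]
        simp only [antipode_mul_antidistrib, mul_assoc]
    _ = sw (Δ h) (fun h₁ q => sw (Δ q) (fun h₂ h₃ => sw (Δ t) (fun a b =>
          G (h₁ * a) (S b * (S h₂ * h₃))))) := by
        rw [sw_comul_assoc] <;> intros <;> fun_prop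
    _ = sw (Δ h) (fun h₁ q => ε q • sw (Δ t) (fun a b => G (h₁ * a) (S b))) := by
        refine sw_congr fun h₁ q => ?_
        rw [sw_antipode_mul' (k := k) q
          (f := fun z => sw (Δ t) (fun a b => G (h₁ * a) (S b * z))) (by fun_prop)]
        simp only [mul_one]
    _ = _ := sw_comul_counit_right (f := fun h => sw (Δ t) (fun a b => G (h * a) (S b))) h
          (by fun_prop)

/-- Maschke's theorem for Hopf algebras. -/
theorem isSemisimpleRing_of_isIntegral {t : H} (ht : IsIntegral k t) (h1 : ε t = 1) :
    IsSemisimpleRing H := by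
  refine (isSemisimpleModule_iff H H).2 ⟨fun N => ?_⟩
  obtain ⟨π, hπ⟩ := (N.restrictScalars k).subtype.exists_leftInverse_of_injective
    (LinearMap.ker_eq_bot.2 Subtype.val_injective)
  let π' : H →ₗ[k] N := π
  have hπ' (x : N) : π' x = x := LinearMap.congr_fun hπ x
  have l : IsLin k (fun y : H => π' y) := IsLin.linearMap π'
  have ls (a : H) : IsLin k (fun y : N => a • y) := ⟨smul_add a, fun c y => smul_comm a c y⟩
  have ls' (y : N) : IsLin k (fun a : H => a • y) :=
    ⟨fun a b => add_smul a b y, fun c a => smul_assoc c a y⟩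
  -- A `k`-linear projection onto `N`, averaged over the integral.
  let f : H →ₗ[H] N :=
    { toFun := fun x => sw (Δ t) (fun a b => a • π' (S b * x))
      map_add' := (show IsLin k (fun x => sw (Δ t) (fun a b => a • π' (S b * x))) from
        .sw_right _ fun a b => (ls a).comp (by fun_prop)).map_add
      map_smul' := fun h x => by
        have hl : IsLin k (fun y : N => h • y) := ls h
        simp only [RingHom.id_apply]
        rw [map_sw (f := fun y : N => h • y) _ _ hl]
        have := ht.sw_mul_antipode (G := fun a b => a • π' (b * x)) (fun b => ls' _)
          (fun a => (ls a).comp (by fun_prop)) h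
        simp only [mul_smul] at this
        rw [this]
        simp [mul_assoc] }
  refine ⟨LinearMap.ker f, LinearMap.isCompl_of_proj (f := f) fun x => ?_⟩
  change sw (Δ t) (fun a b => a • π' (S b * x)) = x
  have : sw (Δ t) (fun a b => a • π' (S b * x)) = sw (Δ t) (fun a b => (a * S b) • x) := by
    refine sw_congr fun a b => ?_
    rw [mul_smul]
    congr 1
    exact hπ' (S b • x)
  rw [this, sw_mul_antipode' (k := k) t (f := fun z => z • x) (ls' x), h1, one_smul, one_smul]

variable [Module.Finite k H]

/-- Split by the central idempotents `t` and `1 - t`: the first part has rank one and trace `ε(t) =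
1`, the second has nonnegative trace. -/
theorem trace_antipode_sq_ne_zero [CharZero k] [IsAlgClosed k] {t : H} (ht : IsIntegral k t)
    (h1 : ε t = 1) : LinearMap.trace k H (S ∘ₗ S) ≠ 0 := by
  have := isSemisimpleRing_of_isIntegral ht h1
  obtain ⟨N, hN, hpow⟩ := exists_pow_antipode_eq_one ht h1
  obtain ⟨φ⟩ := exists_ringHom_complex (K := k)
  let σ : H ≃ₐ[k] H := AlgEquiv.ofBijective
    (AlgHom.ofLinearMap (S ∘ₗ S) (by simp) (by simp [antipode_mul_antidistrib]))
    ((antipode_bijective ht h1).comp (antipode_bijective ht h1))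
  have hσ : σ.toLinearMap = S ∘ₗ S := rfl
  have hσN (x : H) : σ^[N] x = x := by
    have h : σ^[N] x = ((S ∘ₗ S : Module.End k H) ^ N) x := by
      rw [Module.End.coe_pow]; rfl
    rw [h, hpow, Module.End.one_apply]
  have hst : t * t = t := by rw [ht.mul_left, h1, one_smul]
  have := isNonnegVia_trace φ σ hN hσN (1 - t) (by simp [mul_sub, sub_mul, hst])
    (fun x => by simp [mul_sub, sub_mul, ht.mul_left, ht.mul_right])
  have h2 : LinearMap.trace k H (S ∘ₗ S) = 1 + LinearMap.trace k H
      (σ.toLinearMap ∘ₗ LinearMap.mulLeft k (1 - t)) := by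
    have e₁ : (σ.toLinearMap ∘ₗ LinearMap.mulLeft k t) =
        (Coalgebra.counit (R := k) (A := H)).smulRight t := by
      ext x
      rw [hσ]
      simp [ht.mul_right, antipode_isIntegral ht h1]
    have e₂ : (S ∘ₗ S : H →ₗ[k] H) = (σ.toLinearMap ∘ₗ LinearMap.mulLeft k t) +
        (σ.toLinearMap ∘ₗ LinearMap.mulLeft k (1 - t)) := by
      ext x
      rw [hσ]
      simp [sub_mul]
    rw [e₂, map_add, e₁, LinearMap.trace_smulRight, h1]
  rw [h2]
  exact this.one_add_ne_zero

/-- At `x = 1` the defining relation of `g` reads `λ(1) 1 = λ(1) g`, and `λ(1) = Tr S² ≠ 0`, so `g =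
1`. -/
theorem antipode_pow_four_eq_one [CharZero k] [IsAlgClosed k] {t : H} (ht : IsIntegral k t)
    (h1 : ε t = 1) (y : H) : S (S (S (S y))) = y := by
  obtain ⟨g, hg, hx⟩ := exists_isGroupLikeElem ht h1
  have h := hx 1
  have hlam : twistedTrace k H 1 ≠ 0 := by
    rw [twistedTrace_apply, LinearMap.mulLeft_one, LinearMap.id_comp]
    exact trace_antipode_sq_ne_zero ht h1
  rw [Bialgebra.comul_one, sw_one ⟨by intros; fun_prop, by intros; fun_prop⟩] at h
  have hg1 : g = 1 := (smul_right_injective H hlam h).symm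
  have := antipode_pow_four ht h1 hg hx y
  rw [hg1, mul_one, one_mul] at this
  exact this.symm

end Hopf

/-! ### The Larson-Radford theorem. -/

section Hopf

variable {k H : Type*} [Field k] [Ring H] [HopfAlgebra k H]

local notation "Δ" => Coalgebra.comul (R := k)
local notation "S" => HopfAlgebra.antipode k
local notation "ε" => Coalgebra.counit (R := k)

/-- The operator `h ↦ ∑ f(h₁) S²(h₂)`. -/
noncomputable def hitAntipodeSq (f : H →ₗ[k] k) : H →ₗ[k] H :=
  (show IsLin k (fun h => sw (Δ h) (fun a b => f a • S (S b))) by fun_prop).mk'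

theorem hitAntipodeSq_apply (f : H →ₗ[k] k) (h : H) :
    hitAntipodeSq f h = sw (Δ h) (fun a b => f a • S (S b)) := rfl

/-- The operator of `f(x ·)` is `∑ L_{S(x₂)} ∘ hitAntipodeSq f ∘ L_{x₁}`; under the trace the
multiplications combine to `∑ x₁ S(x₂) = ε(x)`. -/
theorem trace_hitAntipodeSq_mulLeft (f : H →ₗ[k] k) (x : H) :
    LinearMap.trace k H (hitAntipodeSq (f ∘ₗ LinearMap.mulLeft k x)) =
      ε x * LinearMap.trace k H (hitAntipodeSq f) := by
  have l₁ (q : H) : IsLin k (fun p : H => LinearMap.mulLeft k (S q) * (hitAntipodeSq f *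
      LinearMap.mulLeft k p)) :=
    ⟨fun p p' => by ext; simp [add_mul, mul_add], fun c p => by ext; simp⟩
  have l₂ (p : H) : IsLin k (fun q : H => LinearMap.mulLeft k (S q) * (hitAntipodeSq f *
      LinearMap.mulLeft k p)) :=
    ⟨fun q q' => by ext; simp [add_mul], fun c q => by ext; simp⟩
  have key : hitAntipodeSq (f ∘ₗ LinearMap.mulLeft k x) = sw (Δ x) (fun p q =>
      LinearMap.mulLeft k (S q) * (hitAntipodeSq f * LinearMap.mulLeft k p)) := by
    ext h
    rw [map_sw (f := fun A : Module.End k H => A h) _ _ (by fun_prop)]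
    simp only [Module.End.mul_apply, LinearMap.mulLeft_apply, hitAntipodeSq_apply,
      LinearMap.comp_apply]
    symm
    calc sw (Δ x) (fun p q => S q * sw (Δ (p * h)) (fun a b => f a • S (S b)))
        = sw (Δ x) (fun p q => sw (Δ p) (fun p₁ p₂ => sw (Δ h) (fun a b =>
            f (p₁ * a) • (S q * S (S p₂) * S (S b))))) := by
          refine sw_congr fun p q => ?_
          rw [sw_comul_mul _ _ (by intros; fun_prop) (by intros; fun_prop),
            map_sw (f := fun z => S q * z) _ _ (by fun_prop)]
          refine sw_congr fun p₁ p₂ => ?_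
          rw [map_sw (f := fun z => S q * z) _ _ (by fun_prop)]
          simp [antipode_mul_antidistrib, mul_assoc]
      _ = sw (Δ x) (fun p₁ q' => sw (Δ q') (fun p₂ q => sw (Δ h) (fun a b =>
            f (p₁ * a) • (S q * S (S p₂) * S (S b))))) := by
          rw [sw_comul_assoc] <;> intros <;> fun_prop
      _ = sw (Δ x) (fun p₁ q' => ε q' • sw (Δ h) (fun a b => f (p₁ * a) • (S (S b)))) := by
          refine sw_congr fun p₁ q' => ?_
          have := sw_antipode_mul' (k := k) q'
            (f := fun z => sw (Δ h) (fun a b => f (p₁ * a) • (S z * S (S b)))) (by fun_prop)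
          simpa [antipode_mul_antidistrib] using this
      _ = _ := sw_comul_counit_right
          (f := fun x => sw (Δ h) (fun a b => f (x * a) • (S (S b)))) x (by fun_prop)
  rw [key, map_sw _ _ (IsLin.linearMap _)]
  calc _ = sw (Δ x) (fun p q => LinearMap.trace k H
        (hitAntipodeSq f * LinearMap.mulLeft k (p * S q))) := by
        refine sw_congr fun p q => ?_
        rw [LinearMap.trace_mul_comm, mul_assoc, LinearMap.mulLeft_mul]
        rfl
    _ = _ := by
        rw [sw_mul_antipode' (k := k) x (f := fun z => LinearMap.trace k H
          (hitAntipodeSq f * LinearMap.mulLeft k z))]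
        · rw [LinearMap.mulLeft_one, ← Module.End.one_eq_id, mul_one, smul_eq_mul]
        · exact ⟨fun p p' => by rw [← map_add]; congr 1; ext; simp [add_mul],
            fun c p => by rw [← map_smul]; congr 1; ext; simp⟩

variable [Module.Finite k H]

/-- The trace is linear in `f`, hence evaluation at some `u`. The preceding lemma makes `u` a left
integral, so `u = ε(u) t`, and `f = ε` gives `ε(u) = Tr S²`. -/
theorem trace_hitAntipodeSq {t : H} (ht : IsIntegral k t) (h1 : ε t = 1) (f : H →ₗ[k] k) :
    LinearMap.trace k H (hitAntipodeSq f) = f t * LinearMap.trace k H (S ∘ₗ S) := by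
  have l : IsLin k (fun f : Module.Dual k H => LinearMap.trace k H (hitAntipodeSq f)) := by
    refine ⟨fun f g => ?_, fun c f => ?_⟩
    · rw [← map_add]
      congr 1
      ext h
      simp only [hitAntipodeSq_apply, LinearMap.add_apply]
      exact (show IsLin k (fun f : H →ₗ[k] k => sw (Δ h) (fun a b => f a • S (S b))) by
        fun_prop).map_add f g
    · rw [← map_smul]
      congr 1
      ext h
      simp only [hitAntipodeSq_apply, LinearMap.smul_apply]
      exact (show IsLin k (fun f : H →ₗ[k] k => sw (Δ h) (fun a b => f a • S (S b))) by
        fun_prop).map_smul c f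
  obtain ⟨u, hu⟩ : ∃ u : H, ∀ f : H →ₗ[k] k, LinearMap.trace k H (hitAntipodeSq f) = f u := by
    refine ⟨(Module.evalEquiv k H).symm l.mk', fun f => ?_⟩
    have := LinearMap.congr_fun ((Module.evalEquiv k H).apply_symm_apply l.mk') f
    exact this.symm
  have hu' (x : H) : x * u = ε x • u := by
    refine (Module.forall_dual_apply_eq_zero_iff k _).1 ?_ |> sub_eq_zero.1
    intro f
    rw [map_sub, sub_eq_zero, map_smul, ← hu f, smul_eq_mul, ← trace_hitAntipodeSq_mulLeft, hu]
    rfl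
  have hε : ε u = LinearMap.trace k H (S ∘ₗ S) := by
    rw [← hu]
    congr 1
    ext h
    exact sw_comul_counit_left (f := fun h => S (S h)) h (by fun_prop)
  rw [hu, ht.eq_smul h1 hu', map_smul, hε, smul_eq_mul, mul_comm]

variable (k H) in
/-- The character of the regular representation. -/
noncomputable def regularChar : H →ₗ[k] k := LinearMap.trace k H ∘ₗ LinearMap.mul k H

omit [Module.Finite k H] in
theorem regularChar_apply (x : H) :
    regularChar k H x = LinearMap.trace k H (LinearMap.mulLeft k x) := rfl

/-- The map `a ⊗ b ↦ Δ(a)(1 ⊗ b)` identifies `H ⊗ H`, with `H` acting on the first factor alone,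
with `H ⊗ H` under the diagonal action. Compare characters. -/
theorem sw_regularChar (x : H) :
    sw (Δ x) (fun a b => regularChar k H a * regularChar k H b) =
      (Module.finrank k H : k) * regularChar k H x := by
  have hF : IsBilin k (fun a b : H => Δ a * ((1 : H) ⊗ₜ[k] b)) :=
    ⟨by intros; fun_prop, by intros; fun_prop⟩
  have hsurj : Function.Surjective hF.lift := by
    intro z
    have key (a b : H) : hF.lift (sw (Δ a) (fun p q => p ⊗ₜ[k] (S q * b))) = a ⊗ₜ[k] b := by
      rw [map_sw _ _ (IsLin.linearMap hF.lift)]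
      calc _ = sw (Δ a) (fun p q => sw (Δ p) (fun p₁ p₂ => p₁ ⊗ₜ[k] (p₂ * S q * b))) := by
            refine sw_congr fun p q => ?_
            rw [IsBilin.lift_tmul]
            conv_lhs => rw [← sw_tmul_self (Δ p)]
            rw [map_sw (f := fun z => z * (1 : H) ⊗ₜ[k] (S q * b)) _ _ (by fun_prop)]
            simp [mul_assoc]
        _ = sw (Δ a) (fun p₁ q' => sw (Δ q') (fun p₂ q => p₁ ⊗ₜ[k] (p₂ * S q * b))) := by
            rw [sw_comul_assoc] <;> intros <;> fun_prop
        _ = sw (Δ a) (fun p₁ q' => ε q' • (p₁ ⊗ₜ[k] b)) := by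
            refine sw_congr fun p₁ q' => ?_
            have := sw_mul_antipode' (k := k) q' (f := fun z => p₁ ⊗ₜ[k] (z * b)) (by fun_prop)
            rwa [one_mul] at this
        _ = _ := sw_comul_counit_right (f := fun a => a ⊗ₜ[k] b) a (by fun_prop)
    induction z with
    | zero => exact ⟨0, map_zero _⟩
    | tmul a b => exact ⟨_, key a b⟩
    | add y z hy hz =>
      obtain ⟨y, rfl⟩ := hy
      obtain ⟨z, rfl⟩ := hz
      exact ⟨y + z, map_add _ _ _⟩
  let Ψ : H ⊗[k] H ≃ₗ[k] H ⊗[k] H :=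
    LinearEquiv.ofBijective hF.lift ⟨LinearMap.injective_iff_surjective.2 hsurj, hsurj⟩
  have hΨ : Ψ.conj (TensorProduct.map (LinearMap.mulLeft k x) LinearMap.id) =
      LinearMap.mulLeft k (Δ x) := by
    apply LinearMap.ext
    intro z
    obtain ⟨z, rfl⟩ := Ψ.surjective z
    rw [LinearEquiv.conj_apply_apply, Ψ.symm_apply_apply]
    have h : Ψ.toLinearMap ∘ₗ TensorProduct.map (LinearMap.mulLeft k x) LinearMap.id =
        LinearMap.mulLeft k (Δ x) ∘ₗ Ψ.toLinearMap := by
      ext a b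
      change hF.lift ((x * a) ⊗ₜ[k] b) = Δ x * hF.lift (a ⊗ₜ[k] b)
      rw [hF.lift_tmul, hF.lift_tmul, Bialgebra.comul_mul, mul_assoc]
    exact LinearMap.congr_fun h z
  have l : IsLin k (fun z : H ⊗[k] H => LinearMap.trace k (H ⊗[k] H) (LinearMap.mulLeft k z)) :=
    IsLin.linearMap (LinearMap.trace k (H ⊗[k] H) ∘ₗ LinearMap.mul k (H ⊗[k] H))
  have e₁ : LinearMap.trace k (H ⊗[k] H) (LinearMap.mulLeft k (Δ x)) =
      sw (Δ x) (fun a b => regularChar k H a * regularChar k H b) := by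
    conv_lhs => rw [← sw_tmul_self (Δ x)]
    rw [map_sw _ _ l]
    refine sw_congr fun a b => ?_
    rw [regularChar_apply, regularChar_apply, ← LinearMap.trace_tensorProduct']
    congr 1
    ext
    simp
  rw [← e₁, ← hΨ, LinearMap.trace_conj', LinearMap.trace_tensorProduct', LinearMap.trace_id,
    mul_comm]
  rfl

/-- `eq_one_of_trace_mul_eq` is applied with `P(h) = ∑ χ(h₁) h₂`, `χ` the regular character. `P² =
(dim H) P` is `sw_regularChar`, and `Tr(S² P) = χ(t) Tr S²` with `χ(t) = 1`. -/
theorem antipode_antipode_of_isAlgClosed [CharZero k] [IsAlgClosed k] {t : H}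
    (ht : IsIntegral k t) (h1 : ε t = 1) (x : H) : S (S x) = x := by
  let P : Module.End k H :=
    (show IsLin k (fun h => sw (Δ h) (fun a b => regularChar k H a • b)) by fun_prop).mk'
  have hP (h : H) : P h = sw (Δ h) (fun a b => regularChar k H a • b) := rfl
  have hinv : Function.Involutive (S ∘ₗ S : H →ₗ[k] H) := fun y =>
    antipode_pow_four_eq_one ht h1 y
  have hχ (y : H) : regularChar k H (S (S y)) = regularChar k H y := by
    have : LinearMap.mulLeft k (S (S y)) =
        (S ∘ₗ S : Module.End k H) * (LinearMap.mulLeft k y * (S ∘ₗ S : Module.End k H)) := by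
      ext z
      have := hinv z
      simp only [LinearMap.comp_apply] at this
      simp [antipode_mul_antidistrib, this]
    rw [regularChar_apply, regularChar_apply, this, LinearMap.trace_mul_comm, mul_assoc]
    congr 1
    ext z
    have := hinv z
    simp only [LinearMap.comp_apply] at this
    simp [this]
  have hSP : (S ∘ₗ S : Module.End k H) * P = hitAntipodeSq (regularChar k H) := by
    ext h
    rw [Module.End.mul_apply, hP, hitAntipodeSq_apply,
      map_sw (f := (S ∘ₗ S : Module.End k H)) _ _ (by fun_prop)]
    simp
  have h1' : (1 : H) ≠ 0 := by
    intro h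
    have : ε (1 : H) = 1 := Bialgebra.counit_one
    rw [h, map_zero] at this
    exact zero_ne_one this
  have := eq_one_of_trace_mul_eq (K := k) (V := H) (σ := S ∘ₗ S) (P := P)
    (LinearMap.ext hinv) ?_ ?_ ?_ (trace_antipode_sq_ne_zero ht h1) h1' (by simp)
  · exact LinearMap.congr_fun this x
  · ext h
    rw [Module.End.mul_apply, LinearMap.smul_apply, hP, hP]
    calc sw (Δ (sw (Δ h) (fun a b => regularChar k H a • b))) (fun a b => regularChar k H a • b)
        = sw (Δ h) (fun a q => sw (Δ q) (fun b c =>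
            (regularChar k H a * regularChar k H b) • c)) := by
          rw [map_sw (f := fun h => sw (Δ h) (fun a b => regularChar k H a • b)) _ _
            (by fun_prop)]
          refine sw_congr fun a b => ?_
          rw [(show IsLin k (fun h => sw (Δ h) (fun a b => regularChar k H a • b)) by
            fun_prop).map_smul, ← sw_smul]
          simp only [mul_smul]
      _ = sw (Δ h) (fun p c => sw (Δ p) (fun a b =>
            (regularChar k H a * regularChar k H b) • c)) := by
          rw [sw_comul_assoc] <;> intros <;> fun_prop
      _ = sw (Δ h) (fun p c => (Module.finrank k H : k) • regularChar k H p • c) := by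
          refine sw_congr fun p c => ?_
          rw [← map_sw (f := fun z => z • c) _ _ (by fun_prop), sw_regularChar, mul_smul]
      _ = _ := by rw [sw_smul]
  · rw [hSP]
    ext h
    rw [Module.End.mul_apply, hP, hitAntipodeSq_apply, LinearMap.comp_apply,
      sw_comul_antipode_antipode _ (by intros; fun_prop) (by intros; fun_prop)]
    simp only [hχ]
  · rw [hSP, trace_hitAntipodeSq ht h1, regularChar_apply]
    have : LinearMap.mulLeft k t = (Coalgebra.counit (R := k) (A := H)).smulRight t := by
      ext z
      simp [ht.mul_right]
    rw [this, LinearMap.trace_smulRight, h1, one_mul]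

/-- The Larson-Radford theorem: the antipode of a finite-dimensional semisimple Hopf algebra over
a field of characteristic zero is an involution. -/
theorem antipode_antipode [CharZero k] {t : H} (ht : IsIntegral k t) (h1 : ε t = 1) (x : H) :
    S (S x) = x := by
  let K := AlgebraicClosure k
  have : CharZero K := charZero_of_injective_algebraMap (algebraMap k K).injective
  have hc (a : K) (x : H) : Coalgebra.counit (R := K) (a ⊗ₜ[k] x) = ε x • a := by simp
  -- The normalized integral survives base change to `K`, and with it semisimplicity, by Maschke.
  have hT : IsIntegral K ((1 : K) ⊗ₜ[k] t) := by
    refine ⟨fun z => ?_, fun z => ?_⟩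
    · induction z with
      | zero => simp
      | tmul a x =>
        rw [hc, Algebra.TensorProduct.tmul_mul_tmul, ht.mul_left, TensorProduct.tmul_smul,
          TensorProduct.smul_tmul', TensorProduct.smul_tmul', smul_eq_mul]
        simp
      | add y z hy hz => rw [add_mul, hy, hz, map_add, add_smul]
    · induction z with
      | zero => simp
      | tmul a x =>
        rw [hc, Algebra.TensorProduct.tmul_mul_tmul, ht.mul_right, TensorProduct.tmul_smul,
          TensorProduct.smul_tmul', TensorProduct.smul_tmul', smul_eq_mul]
        simp
      | add y z hy hz => rw [mul_add, hy, hz, map_add, add_smul]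
  have h := antipode_antipode_of_isAlgClosed hT (by rw [hc, h1, one_smul]) ((1 : K) ⊗ₜ[k] x)
  have h' : (1 : K) ⊗ₜ[k] (S (S x)) = (1 : K) ⊗ₜ[k] x := by simpa using h
  exact Algebra.TensorProduct.includeRight_injective (A := K) (algebraMap k K).injective h'

end Hopf

/-! ### Comodule algebras and the conditional expectation. -/

namespace ComoduleAlgebra

section Bialgebra

variable {k H B M : Type*} [Field k] [Ring H] [Bialgebra k H] [Ring B] [Algebra k B]
  [AddCommGroup M] [Module k M] (ρ : ComoduleAlgebra k H B)

local notation "Δ" => Coalgebra.comul (R := k)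
local notation "ε" => Coalgebra.counit (R := k)

@[fun_prop]
theorem isLin_coaction : IsLin k (fun b => ρ.coaction b) := IsLin.linearMap ρ.coaction.toLinearMap

theorem sw_coaction_assoc (b : B) {F : B → H → H → M} (h₁ : ∀ c d, IsLin k (fun v => F v c d))
    (h₂ : ∀ v d, IsLin k (fun c => F v c d)) (h₃ : ∀ v c, IsLin k (fun d => F v c d)) :
    sw (ρ.coaction b) (fun v d => sw (ρ.coaction v) (fun w c => F w c d)) =
      sw (ρ.coaction b) (fun v q => sw (Δ q) (F v)) := by
  have hG : IsBilin k (fun v (q : H ⊗[k] H) => sw q (F v)) :=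
    ⟨fun _ => by fun_prop, fun a => by fun_prop⟩
  have e := congrArg (fun t => sw t (fun v (q : H ⊗[k] H) => sw q (F v))) (ρ.coassoc b)
  simp only [sw_eq_lift _ hG] at e
  rw [← sw_tmul_self (ρ.coaction b)] at e
  have l₁ : IsLin k (fun t => hG.lift (TensorProduct.assoc k B H H
      (TensorProduct.map ρ.coaction.toLinearMap LinearMap.id t))) :=
    IsLin.linearMap (hG.lift ∘ₗ (TensorProduct.assoc k B H H).toLinearMap ∘ₗ
      TensorProduct.map ρ.coaction.toLinearMap LinearMap.id)
  have l₂ : IsLin k (fun t => hG.lift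
      (TensorProduct.map (LinearMap.id : B →ₗ[k] B) (Coalgebra.comul (R := k) (A := H)) t)) :=
    IsLin.linearMap (hG.lift ∘ₗ TensorProduct.map LinearMap.id comul)
  rw [map_sw _ _ l₁, map_sw _ _ l₂] at e
  simp only [TensorProduct.map_tmul, LinearMap.id_apply, IsBilin.lift_tmul] at e
  simp only [← sw_eq_lift _ hG, sw_assoc _ _ h₁ h₂ h₃] at e
  exact e

theorem sw_coaction_counit (b : B) {f : B → M} (hf : IsLin k f) :
    sw (ρ.coaction b) (fun v c => ε c • f v) = f b := by
  have e := ρ.counit b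
  rw [← sw_tmul_self (ρ.coaction b)] at e
  have l : IsLin k (fun t : B ⊗[k] H => TensorProduct.rid k B
      (TensorProduct.map LinearMap.id (Coalgebra.counit (R := k) (A := H)) t)) :=
    (IsLin.linearEquiv (TensorProduct.rid k B)).comp (IsLin.linearMap (TensorProduct.map
      LinearMap.id (Coalgebra.counit (R := k) (A := H))))
  rw [map_sw _ _ l] at e
  conv_rhs => rw [← e, map_sw _ _ hf]
  refine sw_congr fun v c => ?_
  rw [TensorProduct.map_tmul, TensorProduct.rid_tmul, hf.map_smul]
  rfl

theorem sw_coaction_mul (b c : B) {F : B → H → M} (h₁ : ∀ h, IsLin k (fun v => F v h))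
    (h₂ : ∀ v, IsLin k (F v)) :
    sw (ρ.coaction (b * c)) F =
      sw (ρ.coaction b) (fun v x => sw (ρ.coaction c) (fun w y => F (v * w) (x * y))) := by
  rw [map_mul, sw_mul _ _ ⟨h₁, h₂⟩]

theorem sw_coaction_of_mem {a : B} (ha : a ∈ ρ.coinvariants) {F : B → H → M}
    (h₁ : ∀ h, IsLin k (fun v => F v h)) (h₂ : ∀ v, IsLin k (F v)) :
    sw (ρ.coaction a) F = F a 1 := by
  rw [(ρ.mem_coinvariants a).1 ha, sw_tmul _ _ ⟨h₁, h₂⟩]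

variable (R : Type*) [CommRing R] [Algebra k R] [Algebra R B] [IsScalarTower k R B]
  (hR : ∀ r : R, algebraMap R B r ∈ ρ.coinvariants)

/-- The coaction as an `R`-linear map. -/
def coactionOver : B →ₗ[R] B ⊗[k] H where
  toFun := ρ.coaction
  map_add' := map_add _
  map_smul' r b := by
    rw [Algebra.smul_def, map_mul, (ρ.mem_coinvariants _).1 (hR r), RingHom.id_apply]
    generalize ρ.coaction b = t
    induction t with
    | zero => simp
    | tmul v h => simp [Algebra.smul_def]
    | add t u ht hu => rw [mul_add, ht, hu, smul_add]

@[simp]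
theorem coactionOver_apply (b : B) : ρ.coactionOver R hR b = ρ.coaction b := rfl

end Bialgebra

section Hopf

variable {k H B : Type*} [Field k] [Ring H] [HopfAlgebra k H] [Module.Finite k H]
  [Ring B] [Algebra k B] (ρ : ComoduleAlgebra k H B)
  (R : Type*) [CommRing R] [Algebra k R] [Algebra R B] [IsScalarTower k R B]
  (hR : ∀ r : R, algebraMap R B r ∈ ρ.coinvariants)

local notation "Δ" => Coalgebra.comul (R := k)
local notation "S" => HopfAlgebra.antipode k
local notation "ε" => Coalgebra.counit (R := k)

/-- The map `b ↦ ∑ λ(b₁) b₀` onto the coinvariants, `λ` being the twisted trace of `H`. -/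
noncomputable def expectation : B →ₗ[R] ρ.coinvariantsOver R hR :=
  (contract (ρ.coactionOver R hR) (twistedTrace k H)).codRestrict
    (Subalgebra.toSubmodule (ρ.coinvariantsOver R hR)) fun b => by
      change _ ∈ ρ.coinvariants
      rw [mem_coinvariants, contract_apply, coactionOver_apply, map_sw (f := ρ.coaction) _ _
        (by fun_prop), map_sw (f := fun z => z ⊗ₜ[k] (1 : H)) _ _ (by fun_prop)]
      calc _ = sw (ρ.coaction b) (fun v d => sw (ρ.coaction v) (fun w c =>
              w ⊗ₜ[k] (twistedTrace k H d • c))) := by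
            refine sw_congr fun v d => ?_
            rw [map_smul]
            conv_lhs => rw [← sw_tmul_self (ρ.coaction v), ← sw_smul]
            simp
        _ = _ := by
            rw [sw_coaction_assoc] <;> try (intros; fun_prop)
            refine sw_congr fun v q => ?_
            rw [← map_sw (f := fun z => v ⊗ₜ[k] z) _ _ (by fun_prop), sw_twistedTrace]
            simp [TensorProduct.smul_tmul']

theorem coe_expectation (b : B) : (ρ.expectation R hR b : B) =
    sw (ρ.coaction b) (fun v h => twistedTrace k H h • v) :=
  contract_apply _ _ b

theorem expectation_mul_left (a : ρ.coinvariantsOver R hR) (b : B) :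
    ρ.expectation R hR (a * b) = a * ρ.expectation R hR b := by
  apply Subtype.ext
  rw [MulMemClass.coe_mul, coe_expectation, coe_expectation,
    sw_coaction_mul _ _ _ (by intros; fun_prop) (by intros; fun_prop),
    sw_coaction_of_mem _ a.2 (by intros; fun_prop) (by intros; fun_prop),
    map_sw (f := fun z => (a : B) * z) _ _ (by fun_prop)]
  simp

theorem expectation_mul_right (b : B) (a : ρ.coinvariantsOver R hR) :
    ρ.expectation R hR (b * a) = ρ.expectation R hR b * a := by
  apply Subtype.ext
  rw [MulMemClass.coe_mul, coe_expectation, coe_expectation,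
    sw_coaction_mul _ _ _ (by intros; fun_prop) (by intros; fun_prop),
    map_sw (f := fun z => z * (a : B)) _ _ (by fun_prop)]
  refine sw_congr fun v x => ?_
  rw [sw_coaction_of_mem _ a.2 (by intros; fun_prop) (by intros; fun_prop)]
  simp

variable {R} in
-- Apply `trace_sw_sw` with `F(d, c) = λ(d S(c))`. One order collapses to multiplication by `E(b)`,
-- the other to `λ(1)` times multiplication by `b`. `S² = 1` gives `λ(1) = dim H` and `∑ y₂ S(y₁) =
-- ε(y)`.
theorem trace_expectation {t : H} [CharZero k] (ht : IsIntegral k t) (h1 : ε t = 1) (b : B) :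
    trace R B (ρ.expectation R hR b) = (Module.finrank k H : R) * trace R B b := by
  have hS := antipode_antipode ht h1
  have h1' : twistedTrace k H 1 = (Module.finrank k H : k) := by
    rw [twistedTrace_apply, ← LinearMap.trace_id]
    congr 1
    ext y
    simp [hS]
  have key : LinearMap.trace R B (LinearMap.mulLeft R (ρ.expectation R hR b : B)) =
      LinearMap.trace R B ((Module.finrank k H : R) • LinearMap.mulLeft R b) := by
    refine trace_sw_sw (k := k) (ρ.coactionOver R hR) (LinearMap.mulLeft R b) _ _
      (F := fun d c => twistedTrace k H (d * S c)) (by intros; fun_prop) (by intros; fun_prop)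
      (fun y => ?_) (fun y => ?_)
    · simp only [coactionOver_apply, LinearMap.mulLeft_apply, coe_expectation]
      symm
      calc _ = sw (ρ.coaction y) (fun v c => sw (ρ.coaction b) (fun u x =>
              sw (ρ.coaction v) (fun w d => twistedTrace k H (x * d * S c) • (u * w)))) := by
            refine sw_congr fun v c => ?_
            rw [sw_coaction_mul] <;> intros <;> fun_prop
        _ = sw (ρ.coaction b) (fun u x => sw (ρ.coaction y) (fun v c =>
              sw (ρ.coaction v) (fun w d => twistedTrace k H (x * d * S c) • (u * w)))) :=
            sw_comm _ _ _
        _ = sw (ρ.coaction b) (fun u x => sw (ρ.coaction y) (fun w q =>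
              sw (Δ q) (fun d c => twistedTrace k H (x * d * S c) • (u * w)))) := by
            refine sw_congr fun u x => ?_
            rw [sw_coaction_assoc] <;> intros <;> fun_prop
        _ = sw (ρ.coaction b) (fun u x => sw (ρ.coaction y) (fun w q =>
              ε q • (twistedTrace k H x • (u * w)))) := by
            refine sw_congr fun u x => sw_congr fun w q => ?_
            have := sw_mul_antipode' (k := k) q
              (f := fun z => twistedTrace k H (x * z) • (u * w)) (by fun_prop)
            simpa [mul_assoc] using this
        _ = sw (ρ.coaction b) (fun u x => twistedTrace k H x • (u * y)) := by
            refine sw_congr fun u x => ?_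
            rw [sw_coaction_counit ρ y (f := fun w => twistedTrace k H x • (u * w)) (by fun_prop)]
        _ = _ := by
            rw [map_sw (f := fun z => z * y) _ _ (by fun_prop)]
            simp
    · simp only [coactionOver_apply, LinearMap.smul_apply, LinearMap.mulLeft_apply]
      have e : sw (ρ.coaction y) (fun v c => sw (ρ.coaction v) (fun w d =>
          twistedTrace k H (c * S d) • w)) = (Module.finrank k H : k) • y := by
        rw [sw_coaction_assoc ρ y (F := fun w d c => twistedTrace k H (c * S d) • w)] <;>
          try (intros; fun_prop)
        rw [← sw_coaction_counit ρ y (f := fun z => (Module.finrank k H : k) • z) (by fun_prop)]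
        refine sw_congr fun v q => ?_
        have := sw_mul_antipode' (k := k) q (f := fun z => twistedTrace k H (S z) • v) (by fun_prop)
        simpa [antipode_mul_antidistrib, hS, h1'] using this
      rw [e, mul_smul_comm, Nat.cast_smul_eq_nsmul, Nat.cast_smul_eq_nsmul]
  have e (x : B) : trace R B x = LinearMap.trace R B (LinearMap.mulLeft R x) := rfl
  rw [e, e, key, map_smul, smul_eq_mul]

end Hopf

end ComoduleAlgebra

/-! ### Dual bases and discriminants. -/

section DualBasis

variable {R B : Type*} [CommRing R] [Ring B] [Algebra R B]

/-- If `(r, l)` runs over a Casimir system of the conditional expectation `E : B → A`, then every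
right basis of `B` over `A` has an `E`-dual left basis. -/
theorem exists_dualBasis {A : Subalgebra R B} {E : B →ₗ[R] A}
    (hl : ∀ (a : A) b, E (a * b) = a * E b) (hr : ∀ b (a : A), E (b * a) = E b * a)
    {s : Finset (B × B)} (h₁ : ∀ b, ∑ p ∈ s, p.1 * (E (p.2 * b) : B) = b)
    (h₂ : ∀ b, ∑ p ∈ s, (E (b * p.1) : B) * p.2 = b) {ι : Type*} [Fintype ι] [DecidableEq ι]
    {x : ι → B} (hx : ∀ b, ∃! a : ι → A, b = ∑ i, x i * a i) :
    ∃ y : Module.Basis ι A B, ∀ i j, E (y i * x j) = if i = j then 1 else 0 := by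
  choose f hf hu using hx
  replace hf (b : B) : b = ∑ i, x i * (f b i : B) := hf b
  replace hu (b : B) (a : ι → A) (h : b = ∑ i, x i * (a i : B)) : a = f b := hu b a h
  have f_mul (b : B) (a : A) (i) : f (b * a) i = f b i * a := by
    refine (congrFun (hu (b * a) (fun i => f b i * a) ?_) i).symm
    conv_lhs => rw [hf b]
    simp [Finset.sum_mul, mul_assoc]
  have f_add (b c : B) : f (b + c) = f b + f c := by
    refine (hu _ _ ?_).symm
    conv_lhs => rw [hf b, hf c]
    simp [mul_add, Finset.sum_add_distrib]
  have f_sum (i) (g : B × B → B) : f (∑ p ∈ s, g p) i = ∑ p ∈ s, f (g p) i := by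
    rw [← AddMonoidHom.mk'_apply f f_add, map_sum]
    simp
  have f_single (j i) : f (x j) i = if i = j then 1 else 0 := by
    refine (congrFun (hu (x j) (fun i => if i = j then 1 else 0) ?_) i).symm
    simp [apply_ite]
  -- The `i`-th coordinate, right `A`-linear, is applied to the first leg of the Casimir system, so
  -- that `E(y_i ·)` is this coordinate.
  let y (i : ι) : B := ∑ p ∈ s, (f p.1 i : B) * p.2
  have hy (i : ι) (b : B) : E (y i * b) = f b i := by
    conv_rhs => rw [← h₁ b, f_sum]
    simp [y, Finset.sum_mul, mul_assoc, hl, f_mul]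
  have hy' (i j) : E (y i * x j) = if i = j then 1 else 0 := by rw [hy, f_single]
  have hb (b : B) : ∑ i, (E (b * x i) : B) * y i = b := by
    conv_rhs => rw [← h₂ b]
    simp only [y, Finset.mul_sum]
    rw [Finset.sum_comm]
    refine Finset.sum_congr rfl fun p _ => ?_
    conv_rhs => rw [hf p.1, Finset.mul_sum]
    simp [← mul_assoc, hr, Finset.sum_mul]
  refine ⟨Module.Basis.mk (v := y) (Fintype.linearIndependent_iff.2 fun g hg j => ?_) ?_,
    fun i j => by rw [Module.Basis.mk_apply, hy']⟩
  · have := congrArg (fun b => E (b * x j)) hg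
    simpa [Finset.sum_mul, Subalgebra.smul_def, mul_assoc, hl, hy'] using this
  · intro b _
    rw [← hb b]
    exact Submodule.sum_mem _ fun i _ => Submodule.smul_mem _ (E (b * x i))
      (Submodule.subset_span ⟨i, rfl⟩)

/-- The trace of `a ∈ A` on a free left `A`-module `B`. -/
theorem trace_of_basis {A : Subalgebra R B} {ι κ : Type*} [Fintype ι] [Fintype κ] [DecidableEq ι]
    [DecidableEq κ] (y : Module.Basis ι A B) (z : Module.Basis κ R A) (a : A) :
    trace R B a = (Fintype.card ι : R) * trace R A a := by
  have h₁ : trace R B a = LinearMap.trace R B (LinearMap.mulLeft R (a : B)) := rfl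
  have h₂ : trace R A a = LinearMap.trace R A (LinearMap.mulLeft R a) := rfl
  rw [h₁, h₂, LinearMap.trace_eq_matrix_trace R (z.smulTower y),
    LinearMap.trace_eq_matrix_trace R z,
    Matrix.trace, Matrix.trace, Fintype.sum_prod_type, Finset.mul_sum]
  refine Finset.sum_congr rfl fun p _ => ?_
  have (i : ι) : (a : B) * (z p • y i) = (a * z p) • y i := by
    simp [Subalgebra.smul_def, mul_assoc]
  simp only [Matrix.diag_apply, LinearMap.toMatrix_apply, Module.Basis.smulTower_repr,
    Module.Basis.smulTower_apply, LinearMap.mulLeft_apply, this]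
  simp

/-- The bases in the two arguments of a bilinear form may be changed independently, each at the cost
of an invertible determinant. -/
theorem exists_det_eq_mul {V ι : Type*} [AddCommGroup V] [Module R V] [Fintype ι] [DecidableEq ι]
    (β : V →ₗ[R] V →ₗ[R] R) (w y x : Module.Basis ι R V) :
    ∃ u : Rˣ, Matrix.det (Matrix.of fun i j => β (w i) (w j)) =
      u * Matrix.det (Matrix.of fun i j => β (y i) (x j)) := by
  have h (b c : Module.Basis ι R V) : (Matrix.of fun i j => β (b i) (c j)) =
      LinearMap.toMatrix₂ b c β := by
    ext i j
    simp [LinearMap.toMatrix₂_apply]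
  have e := LinearMap.toMatrix₂_mul_basis_toMatrix (b₁ := y) (b₂ := x) w w β
  have := y.invertibleToMatrix w
  have := x.invertibleToMatrix w
  have u₁ := Matrix.isUnit_det_of_invertible (y.toMatrix w)
  have u₂ := Matrix.isUnit_det_of_invertible (x.toMatrix w)
  refine ⟨u₁.unit * u₂.unit, ?_⟩
  rw [h, h, ← e, Matrix.det_mul, Matrix.det_mul, Matrix.det_transpose, Units.val_mul,
    IsUnit.unit_spec, IsUnit.unit_spec]
  ring

end DualBasis

section Discriminant

variable {R B : Type*} [CommRing R] [Ring B] [Algebra R B]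

/-- Use the basis `z_p y_i` on the left and `x_j z_q` on the right: `E(z_p y_i x_j z_q) = δ_ij z_p
z_q`, so the Gram matrix is block diagonal. -/
theorem exists_det_dualBasis {A : Subalgebra R B} {E : B →ₗ[R] A}
    (hl : ∀ (a : A) b, E (a * b) = a * E b) (hr : ∀ b (a : A), E (b * a) = E b * a)
    {ι κ : Type*} [Fintype ι] [DecidableEq ι] [Fintype κ] [DecidableEq κ]
    {x : ι → B} (hx : ∀ b, ∃! a : ι → A, b = ∑ i, x i * a i) {y : Module.Basis ι A B}
    (hxy : ∀ i j, E (y i * x j) = if i = j then 1 else 0) (z : Module.Basis κ R A)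
    (w : Module.Basis (κ × ι) R B) :
    ∃ u : Rˣ, Matrix.det (Matrix.of fun i j => trace R A (E (w i * w j))) =
      u * Matrix.det (Matrix.of fun i j => trace R A (z i * z j)) ^ Fintype.card ι := by
  let g : (ι → A) →ₗ[R] B := ∑ i, LinearMap.mulLeft R (x i) ∘ₗ A.val.toLinearMap ∘ₗ LinearMap.proj i
  have hg (a : ι → A) : g a = ∑ i, x i * a i := by simp [g]
  let e : (ι → A) ≃ₗ[R] B := LinearEquiv.ofBijective g <| by
    refine (Function.bijective_iff_existsUnique _).2 fun b => ?_
    simpa only [hg, eq_comm] using hx b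
  let X : Module.Basis (κ × ι) R B := ((Pi.basis fun _ : ι => z).map e).reindex
    ((Equiv.sigmaEquivProd ι κ).trans (Equiv.prodComm ι κ))
  have hX (p : κ × ι) : X p = x p.2 * z p.1 := by
    have : X p = g (Pi.single p.2 (z p.1)) := by
      simp [X, e]
    rw [this, hg, Finset.sum_eq_single p.2] <;> simp +contextual
  let β : B →ₗ[R] B →ₗ[R] R := (LinearMap.mul R B).compr₂ (trace R A ∘ₗ E)
  obtain ⟨u, hu⟩ := exists_det_eq_mul β w (z.smulTower y) X
  refine ⟨u, hu.trans ?_⟩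
  have : (Matrix.of fun i j => β (z.smulTower y i) (X j)) =
      Matrix.blockDiagonal fun _ : ι => Matrix.of fun i j => trace R A (z i * z j) := by
    ext ⟨p, i⟩ ⟨q, j⟩
    have h : E (z p * y i * (x j * z q)) = z p * (E (y i * x j) * z q) := by
      rw [← hr, ← hl]
      simp only [mul_assoc]
    rw [Matrix.blockDiagonal_apply]
    simp only [β, Matrix.of_apply, LinearMap.compr₂_apply, LinearMap.mul_apply', hX,
      Module.Basis.smulTower_apply, Subalgebra.smul_def, smul_eq_mul, LinearMap.comp_apply, h, hxy]
    split_ifs <;> simp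
  rw [this, Matrix.det_blockDiagonal, Finset.prod_const, Finset.card_univ]

end Discriminant

/-! ### The Casimir element of a Galois extension. -/

namespace ComoduleAlgebra

variable {k H B : Type*} [Field k] [Ring H] [HopfAlgebra k H]
  [Ring B] [Algebra k B] (ρ : ComoduleAlgebra k H B)

local notation "Δ" => Coalgebra.comul (R := k)
local notation "S" => HopfAlgebra.antipode k
local notation "ε" => Coalgebra.counit (R := k)

theorem sw_preCanonicalMap {M : Type*} [AddCommGroup M] [Module k M] (c : B ⊗[k] B) {F : B → H → M}
    (h₁ : ∀ h, IsLin k (fun v => F v h)) (h₂ : ∀ v, IsLin k (F v)) :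
    sw (ρ.preCanonicalMap c) F =
      sw c (fun r l => sw (ρ.coaction l) (fun v h => F (r * v) h)) := by
  have hF : IsBilin k F := ⟨h₁, h₂⟩
  rw [sw_eq_lift _ hF]
  conv_lhs => rw [← sw_tmul_self c]
  rw [map_sw (f := fun c => hF.lift (ρ.preCanonicalMap c)) _ _ (by fun_prop)]
  refine sw_congr fun r l => ?_
  rw [← sw_eq_lift, preCanonicalMap_tmul, sw_mul _ _ hF,
    sw_tmul _ _ ⟨by intros; fun_prop, by intros; fun_prop⟩]
  simp

/-- If `∑ r l₀ ⊗ l₁ = 1 ⊗ t`, then `∑ r₀ l ⊗ r₁ = 1 ⊗ S(t)`. -/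
theorem sw_of_preCanonicalMap {M : Type*} [AddCommGroup M] [Module k M] {c : B ⊗[k] B} {t : H}
    (hc : ρ.preCanonicalMap c = 1 ⊗ₜ[k] t) {F : B → H → M}
    (h₁ : ∀ h, IsLin k (fun v => F v h)) (h₂ : ∀ v, IsLin k (F v)) :
    sw c (fun r l => sw (ρ.coaction r) (fun v h => F (v * l) h)) = F 1 (S t) := by
  have e := ρ.sw_preCanonicalMap c (F := fun w h => sw (ρ.coaction w) (fun v x => F v (x * S h)))
    (by intros; fun_prop) (by intros; fun_prop)
  rw [hc, sw_tmul _ _ ⟨by intros; fun_prop, by intros; fun_prop⟩, map_one,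
    sw_one ⟨by intros; fun_prop, by intros; fun_prop⟩, one_mul] at e
  rw [e]
  refine sw_congr fun r l => ?_
  symm
  calc _ = sw (ρ.coaction l) (fun v h => sw (ρ.coaction r) (fun r' x => sw (ρ.coaction v)
          (fun v' y => F (r' * v') (x * y * S h)))) := by
        refine sw_congr fun v h => ?_
        rw [sw_coaction_mul] <;> intros <;> fun_prop
    _ = sw (ρ.coaction r) (fun r' x => sw (ρ.coaction l) (fun v h => sw (ρ.coaction v)
          (fun v' y => F (r' * v') (x * y * S h)))) := sw_comm _ _ _
    _ = sw (ρ.coaction r) (fun r' x => sw (ρ.coaction l) (fun v q => sw (Δ q)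
          (fun y h => F (r' * v) (x * y * S h)))) := by
        refine sw_congr fun r' x => ?_
        rw [sw_coaction_assoc] <;> intros <;> fun_prop
    _ = sw (ρ.coaction r) (fun r' x => sw (ρ.coaction l) (fun v q => ε q • F (r' * v) x)) := by
        refine sw_congr fun r' x => sw_congr fun v q => ?_
        have := sw_mul_antipode' (k := k) q (f := fun z => F (r' * v) (x * z)) (by fun_prop)
        simpa [mul_assoc] using this
    _ = _ := by
        refine sw_congr fun r' x => ?_
        rw [sw_coaction_counit ρ l (f := fun v => F (r' * v) x) (by fun_prop)]

variable [Module.Finite k H] {R : Type*} [CommRing R] [Algebra k R] [Algebra R B]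
  [IsScalarTower k R B] (hR : ∀ r : R, algebraMap R B r ∈ ρ.coinvariants)

/-- Since `∑ r l₀ ⊗ l₁ = 1 ⊗ t`, the sum is `∑ λ(t b₁) b₀`, which `t b₁ = ε(b₁) t` and `λ(t) = 1`
reduce to `b`. -/
theorem sw_mul_expectation {t : H} (ht : IsIntegral k t) (h1 : ε t = 1) {c : B ⊗[k] B}
    (hc : ρ.preCanonicalMap c = 1 ⊗ₜ[k] t) (b : B) :
    sw c (fun r l => r * (ρ.expectation R hR (l * b) : B)) = b := by
  have e := ρ.sw_preCanonicalMap c (F := fun v h => sw (ρ.coaction b)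
    (fun w x => twistedTrace k H (h * x) • (v * w))) (by intros; fun_prop) (by intros; fun_prop)
  rw [hc, sw_tmul _ _ ⟨by intros; fun_prop, by intros; fun_prop⟩] at e
  simp only [ht.mul_right, map_smul, twistedTrace_integral ht, h1, one_mul, smul_eq_mul,
    mul_one] at e
  rw [sw_coaction_counit ρ b (f := fun w => w) (by fun_prop)] at e
  refine Eq.trans ?_ e.symm
  refine sw_congr fun r l => ?_
  rw [coe_expectation, sw_coaction_mul _ _ _ (by intros; fun_prop) (by intros; fun_prop),
    map_sw (f := fun z => r * z) _ _ (by fun_prop)]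
  refine sw_congr fun v h => ?_
  rw [map_sw (f := fun z => r * z) _ _ (by fun_prop)]
  simp [mul_assoc]

/-- The mirror computation has `S(t)` in place of `t`; it closes because `S(t) = t`. -/
theorem sw_expectation_mul {t : H} (ht : IsIntegral k t) (h1 : ε t = 1) {c : B ⊗[k] B}
    (hc : ρ.preCanonicalMap c = 1 ⊗ₜ[k] t) (b : B) :
    sw c (fun r l => (ρ.expectation R hR (b * r) : B) * l) = b := by
  have e := ρ.sw_of_preCanonicalMap hc (F := fun v h => sw (ρ.coaction b)
    (fun w x => twistedTrace k H (x * h) • (w * v))) (by intros; fun_prop) (by intros; fun_prop)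
  simp only [antipode_isIntegral ht h1, ht.mul_left, map_smul, twistedTrace_integral ht, h1,
    mul_one, smul_eq_mul] at e
  rw [sw_coaction_counit ρ b (f := fun w => w) (by fun_prop)] at e
  refine Eq.trans ?_ e
  refine sw_congr fun r l => ?_
  rw [sw_comm, coe_expectation,
    sw_coaction_mul _ _ _ (by intros; fun_prop) (by intros; fun_prop),
    map_sw (f := fun z => z * l) _ _ (by fun_prop)]
  refine sw_congr fun v h => ?_
  rw [map_sw (f := fun z => z * l) _ _ (by fun_prop)]
  simp [mul_assoc]

theorem exists_casimir [IsSemisimpleRing H] (hGal : ρ.IsGalois) : ∃ s : Finset (B × B),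
    (∀ b, ∑ p ∈ s, p.1 * (ρ.expectation R hR (p.2 * b) : B) = b) ∧
      ∀ b, ∑ p ∈ s, (ρ.expectation R hR (b * p.1) : B) * p.2 = b := by
  obtain ⟨t, ht, h1⟩ := exists_isIntegral k H
  obtain ⟨c, hc⟩ := hGal.2 (1 ⊗ₜ[k] t)
  obtain ⟨c, rfl⟩ := Submodule.Quotient.mk_surjective _ c
  -- The finite set is the representation of `c` chosen inside `sw`, so both identities hold by
  -- unfolding.
  exact ⟨_, ρ.sw_mul_expectation hR ht h1 hc, ρ.sw_expectation_mul hR ht h1 hc⟩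

end ComoduleAlgebra

namespace ComoduleAlgebra

variable {k H B : Type*} [Field k] [Ring H] [HopfAlgebra k H] [Module.Finite k H]
  [IsSemisimpleRing H] [Ring B] [Algebra k B] (ρ : ComoduleAlgebra k H B)
  {R : Type*} [CommRing R] [Algebra k R] [Algebra R B]
  [IsScalarTower k R B] (hR : ∀ r : R, algebraMap R B r ∈ ρ.coinvariants)

theorem exists_basis_coinvariantsOver (hGal : ρ.IsGalois) {m : ℕ} {x : Fin m → B}
    (hx : ∀ b, ∃! a : Fin m → ρ.coinvariantsOver R hR, b = ∑ i, x i * a i) :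
    ∃ y : Module.Basis (Fin m) (ρ.coinvariantsOver R hR) B,
      ∀ i j, ρ.expectation R hR (y i * x j) = if i = j then 1 else 0 := by
  obtain ⟨s, h₁, h₂⟩ := ρ.exists_casimir hR hGal
  exact exists_dualBasis (ρ.expectation_mul_left R hR) (ρ.expectation_mul_right R hR) h₁ h₂ hx

/-- Computing `tr_B(E(b))` twice gives `dim H · tr_B(b) = m · tr_A(E(b))`. -/
theorem trace_eq_smul_expectation [CharZero k] {κ : Type*} [Fintype κ] [DecidableEq κ] {m : ℕ}
    (y : Module.Basis (Fin m) (ρ.coinvariantsOver R hR) B)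
    (z : Module.Basis κ R (ρ.coinvariantsOver R hR)) (b : B) :
    trace R B b = ((Module.finrank k H : k)⁻¹ * m) •
      trace R (ρ.coinvariantsOver R hR) (ρ.expectation R hR b) := by
  obtain ⟨t, ht, h1⟩ := exists_isIntegral k H
  have : Nontrivial H := ⟨t, 0, fun h => by simp [h] at h1⟩
  have hn : (Module.finrank k H : k) ≠ 0 := Nat.cast_ne_zero.2 Module.finrank_pos.ne'
  have e := ρ.trace_expectation hR ht h1 b
  rw [trace_of_basis y z, Fintype.card_fin] at e
  rw [mul_smul, Nat.cast_smul_eq_nsmul, nsmul_eq_mul, e, ← nsmul_eq_mul,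
    ← Nat.cast_smul_eq_nsmul k, inv_smul_smul₀ hn]

end ComoduleAlgebra

end HopfGalois

/-! ### The discriminant formula. -/

theorem mainTheorem6 {k H B R : Type*} [Field k] [CharZero k]
    [Ring H] [HopfAlgebra k H] [Module.Finite k H] [IsSemisimpleRing H]
    [Ring B] [Algebra k B]
    (ρ : HopfGalois.ComoduleAlgebra k H B) (hGal : ρ.IsGalois)
    [CommRing R] [Algebra k R] [Algebra R B] [IsScalarTower k R B]
    (hinj : Function.Injective (algebraMap R B))
    (hR : ∀ r : R, algebraMap R B r ∈ ρ.coinvariants)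
    [Module.Free R (ρ.coinvariantsOver R hR)] [Module.Finite R (ρ.coinvariantsOver R hR)]
    (m : ℕ) (hm : HopfGalois.IsFreeRight ρ.coinvariants m) :
    (Module.Free R B ∧ Module.Finite R B) ∧
    (∀ (p q : ℕ) (w : Module.Basis (Fin p) R B)
        (z : Module.Basis (Fin q) R (ρ.coinvariantsOver R hR)),
      ∃ u : Rˣ,
        HopfGalois.discriminant (HopfGalois.trace R B) w =
          u * HopfGalois.discriminant (HopfGalois.trace R (ρ.coinvariantsOver R hR)) z ^ m) ∧
    ((∀ u : Rˣ, ∃ c : k, algebraMap k R c = u) →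
      ∀ (p q : ℕ) (w : Module.Basis (Fin p) R B)
        (z : Module.Basis (Fin q) R (ρ.coinvariantsOver R hR)),
      ∃ c : k, c ≠ 0 ∧
        HopfGalois.discriminant (HopfGalois.trace R B) w =
          algebraMap k R c *
            HopfGalois.discriminant (HopfGalois.trace R (ρ.coinvariantsOver R hR)) z ^ m) := by
  obtain ⟨x, hx⟩ := hm
  replace hx : ∀ b, ∃! a : Fin m → ρ.coinvariantsOver R hR, b = ∑ i, x i * a i := hx
  obtain ⟨y, hxy⟩ := ρ.exists_basis_coinvariantsOver hR hGal hx
  have key (p q : ℕ) (w : Module.Basis (Fin p) R B)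
      (z : Module.Basis (Fin q) R (ρ.coinvariantsOver R hR)) : ∃ u : Rˣ,
      HopfGalois.discriminant (HopfGalois.trace R B) w =
        u * HopfGalois.discriminant (HopfGalois.trace R (ρ.coinvariantsOver R hR)) z ^ m := by
    cases subsingleton_or_nontrivial R with
    | inl h => exact ⟨1, Subsingleton.elim _ _⟩
    | inr h =>
      obtain ⟨t, ht, h1⟩ := HopfGalois.exists_isIntegral k H
      have : Nontrivial H := ⟨t, 0, fun h => by simp [h] at h1⟩
      have : Nontrivial B := hinj.nontrivial
      -- Nonvanishing of `m` makes the scalar `m / dim H` invertible.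
      have hm : m ≠ 0 := by
        rintro rfl
        exact not_subsingleton B y.repr.toEquiv.subsingleton
      have hc : (Module.finrank k H : k)⁻¹ * m ≠ 0 :=
        mul_ne_zero (inv_ne_zero (Nat.cast_ne_zero.2 Module.finrank_pos.ne'))
          (Nat.cast_ne_zero.2 hm)
      let e := w.indexEquiv (z.smulTower y)
      obtain ⟨u, hu⟩ := HopfGalois.exists_det_dualBasis (ρ.expectation_mul_left R hR)
        (ρ.expectation_mul_right R hR) hx hxy z (w.reindex e)
      -- The scalar multiplies a `p × p` matrix, hence the exponent `p`; `u` comes from the changes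
      -- of basis.
      refine ⟨((Units.mk0 _ hc).map (algebraMap k R).toMonoidHom) ^ p * u, ?_⟩
      have hw : (Matrix.of fun i j => HopfGalois.trace R (ρ.coinvariantsOver R hR)
          (ρ.expectation R hR (w.reindex e i * w.reindex e j))) =
          Matrix.reindex e e (Matrix.of fun i j => HopfGalois.trace R (ρ.coinvariantsOver R hR)
            (ρ.expectation R hR (w i * w j))) := by
        ext i j
        simp
      rw [hw, Matrix.det_reindex_self, Fintype.card_fin] at hu
      have hd : (Matrix.of fun i j => HopfGalois.trace R B (w i * w j)) =
          algebraMap k R ((Module.finrank k H : k)⁻¹ * m) •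
            Matrix.of fun i j => HopfGalois.trace R (ρ.coinvariantsOver R hR)
              (ρ.expectation R hR (w i * w j)) := by
        ext i j
        rw [Matrix.of_apply, ρ.trace_eq_smul_expectation hR y z, Algebra.smul_def]
        rfl
      rw [HopfGalois.discriminant, hd, Matrix.det_smul, hu, Fintype.card_fin, ← mul_assoc]
      rfl
  have z := Module.Free.chooseBasis R (ρ.coinvariantsOver R hR)
  refine ⟨⟨Module.Free.of_basis (z.smulTower y), Module.Finite.of_basis (z.smulTower y)⟩, key,
    fun h p q w z => ?_⟩
  cases subsingleton_or_nontrivial R with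
  | inl _ => exact ⟨1, one_ne_zero, Subsingleton.elim _ _⟩
  | inr _ =>
    obtain ⟨u, hu⟩ := key p q w z
    obtain ⟨c, hc⟩ := h u
    refine ⟨c, ?_, by rw [hu, hc]⟩
    rintro rfl
    exact u.ne_zero (by rw [← hc, map_zero])
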